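/- **Setting.** Simple types are built from sorts with $\to$; the theory sorts include $\mathsf{int}$ and $\mathsf{bool}$, interpreted as $\mathbb Z$ and $\{\top,\bot\}$. Terms are well-typed applicative terms $s\,t$ over typed function symbols and typed variables. The theory symbols include the integer literals, $\mathsf{true},\mathsf{false}$, $+,-,*,=,<,\le,>,\ge,\wedge,\vee,\neg$ with the usual interpretation; each theory symbol has a type $\iota_1\to\dots\to\iota_m\to\kappa$ over theory sorts and an interpretation. Values are the theory symbols whose type is a sort; the values of sort $\mathsf{int}$ are exactly the integer literals. A constraint is a term of type $\mathsf{bool}$ built from theory symbols and variables of theory sorts. A substitution $\gamma$ respects a constraint $\varphi$ if it maps all variables of $\varphi$ to values and $\varphi\gamma$ evaluates to $\top$. Let $\mathcal R$ be the rules of a logically constrained simply-typed term rewriting system: rules $\ell\to r\ [\varphi]$ with $\ell=\mathsf f\,\ell_1\cdots\ell_k$ not a theory term, $\mathrm{Var}(r)\subseteq \mathrm{Var}(\ell)\cup\mathrm{Var}(\varphi)$, and each symbol $\mathsf f$ having a unique arity (the number $k$ of arguments in the left-hand sides of its rules, calculation rules included; $\infty$ if there are no rules). The relation $\to_{\mathcal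 R}$ is the closure under contexts of the steps $\ell\gamma\to r\gamma$ with $\gamma$ respecting $\varphi$, for the rules of $\mathcal R$ and for the calculation rules $\mathsf f\,x_1\cdots x_m\to y\ [y=\mathsf f\,x_1\cdots x_m]$ of the non-value theory symbols $\mathsf f$. A term is a semi-constructor term if in each of its subterms $\mathsf f\,s_1\cdots s_n$ the number $n$ is smaller than the arity of $\mathsf f$. Assume that $\mathcal R$ is quasi-reductive (irreducible ground terms are semi-constructor terms), that the only ground semi-constructor terms of sort $\mathsf{int}$ are the integer literals, and that $\mathcal R$ contains the rules $$\begin{aligned} \mathsf{tailup}\ f\ i\ y\ a&\to a\ [i>y], & \mathsf{tailup}\ f\ i\ y\ a&\to\mathsf{tailup}\ f\ (i+1)\ y\ (f\ i\ a)\ [i\le y],\\ \mathsf{taildn}\ f\ x\ i\ a&\to a\ [i<x], & \mathsf{taildn}\ f\ x\ i\ a&\to\mathsf{taildn}\ f\ x\ (i-1)\ (f\ a\ i)\ [i\ge x],\\ \mathsf{recup}\ f\ i\ y\ z&\to z\ [i>y], & \mathsf{recup}\ f\ i\ y\ z&\to f\ (\mathsf{recup}\ f\ (i+1)\ y\ z)\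 i\ [i\le y],\\ \mathsf{recdn}\ f\ x\ i\ z&\to z\ [i<x], & \mathsf{recdn}\ f\ x\ i\ z&\to f\ i\ (\mathsf{recdn}\ f\ x\ (i-1)\ z)\ [i\ge x], \end{aligned}$$ with $f::\mathsf{int}\to\mathsf{int}\to\mathsf{int}$ and the other variables of type $\mathsf{int}$. Let $\succ$ be a well-founded ordering on terms that includes $\to_{\mathcal R}$ and the proper subterm relation, and let $\succeq$ be its reflexive closure. **Notions.** $s\succ t\ [\varphi]$ means that $s\gamma\succ t\gamma$ for all ground substitutions $\gamma$ that respect $\varphi$ and have $\mathrm{Var}(s)\cup\mathrm{Var}(t)\subseteq\mathrm{dom}(\gamma)$. An equation $s\approx t\ [\varphi]$ is a *bounded inductive theorem* if $s=t$ or, for every such $\gamma$, there are $n\ge 0$, ground contexts $C_0,\dots,C_n$ and ground terms $s_0,t_0,\dots,s_n,t_n$ with $s\gamma=C_0[s_0]$, $C_{i-1}[t_{i-1}]=C_i[s_i]$ for $1\le i\le n$, $C_n[t_n]=t\gamma$, such that for all $i$: $s_i\to_{\mathcal R}t_i$ or $t_i\to_{\mathcal R}s_i$; $s\gamma\succeq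 s_i$ or $t\gamma\succeq s_i$; and $s\gamma\succeq t_i$ or $t\gamma\succeq t_i$. For sets $\mathcal A,\mathcal E$ of equations and $\mathcal O$ of ordering requirements $s\succ t\ [\varphi]$ that may contain placeholders $\square_1,\square_2::\mathsf{int}\to\mathsf{int}\to\mathsf{int}$, "$\mathcal A\vdash\mathcal E$ if $\mathcal O$" is a *conditional bounded inductive theorem* if, for all terms $s_1,s_2$ of type $\mathsf{int}\to\mathsf{int}\to\mathsf{int}$ in which the variables of $\mathcal A,\mathcal E,\mathcal O$ do not occur, the following holds after replacing $\square_1,\square_2$ by $s_1,s_2$: if all members of $\mathcal A$ are bounded inductive theorems and all members of $\mathcal O$ hold, then all members of $\mathcal E$ are bounded inductive theorems. **Claim.** Let $x,y,z,a,x_1,x_2,y_1,y_2$ be distinct variables of type $\mathsf{int}$; an omitted constraint is $\mathsf{true}$. The following are conditional bounded inductive theorems. (1) $\{\square_1\,x\,(\square_2\,y\,z)\approx\square_2\,(\square_1\,x\,y)\,z,\ \ \square_1\,x\,y\approx\square_2\,y\,x\}\vdash\{\mathsf{tailup}\ \square_1\,x\,y\,a\approx\mathsf{taildn}\ \square_2\,x\,y\,a\}$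 if - $\mathsf{tailup}\ \square_1\,x\,y\,a\succ\mathsf{taildn}\ \square_2\,x_1\,y\,(\square_1\,x\,a)\ [x\le y\wedge x_1=x+1\wedge y_1=y-1]$, - $\mathsf{taildn}\ \square_2\,x_1\,y\,(\square_1\,x\,a)\succ\mathsf{taildn}\ \square_2\,x_1\,y_1\,(\square_1\,x\,(\square_2\,a\,y))\ [x\le y\wedge x_1=x+1\wedge y_1=y-1\wedge x_1\le y]$. (2) $\{\square_1\,x\,(\square_1\,y\,z)\approx\square_1\,y\,(\square_1\,x\,z),\ \ \square_1\,x\,y\approx\square_2\,y\,x\}\vdash\{\mathsf{taildn}\ \square_2\,x\,y\,a\approx\mathsf{recdn}\ \square_1\,x\,y\,a\}$ if - $\mathsf{taildn}\ \square_2\,x\,y\,a\succ\mathsf{recdn}\ \square_1\,x\,y_1\,(\square_2\,a\,y)\ [x\le y\wedge y_1=y-1]$, - $\mathsf{recdn}\ \square_1\,x\,y_1\,(\square_2\,a\,y)\succ\square_1\,y_1\,(\square_1\,y\,(\mathsf{recdn}\ \square_1\,x\,y_2\,a))\ [x\le y\wedge x\le y_1\wedge y_2=y_1-1]$. (3) $\{\square_1\,(\square_1\,x\,y)\,z\approx\square_1\,(\square_1\,x\,z)\,y,\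 \ \square_1\,x\,y\approx\square_2\,y\,x\}\vdash\{\mathsf{tailup}\ \square_2\,x\,y\,a\approx\mathsf{recup}\ \square_1\,x\,y\,a\}$ if - $\mathsf{tailup}\ \square_2\,x\,y\,a\succ\mathsf{recup}\ \square_1\,x_1\,y\,(\square_2\,x\,a)\ [x\le y\wedge x_1=x+1]$, - $\mathsf{recup}\ \square_1\,x_1\,y\,(\square_2\,x\,a)\succ\square_1\,(\square_1\,(\mathsf{recup}\ \square_1\,x_2\,y\,a)\,x)\,x_1\ [x\le y\wedge x_1\le y\wedge x_2=x_1+1]$. (4) $\{\square_1\,(\square_2\,x\,y)\,z\approx\square_2\,x\,(\square_1\,y\,z),\ \ \square_1\,x\,y\approx\square_2\,y\,x\}\vdash\{\mathsf{recup}\ \square_1\,x\,y\,a\approx\mathsf{recdn}\ \square_2\,x\,y\,a\}$ if - $\mathsf{recup}\ \square_1\,x\,y\,a\succ\square_1\,(\mathsf{recdn}\ \square_2\,x_1\,y\,a)\,x\ [x\le y\wedge x_1=x+1]$, - $\square_2\,y\,(\mathsf{recdn}\ \square_2\,x\,y_1\,a)\succ\square_2\,y\,(\square_1\,(\mathsf{recdn}\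 \square_2\,x_1\,y_1\,a)\,x)\ [x\le y\wedge x_1=x+1\wedge y_1=y-1\wedge x_1\le y]$. -/

import Mathlib

/-! Logically constrained simply-typed term rewriting systems, bounded ground convertibility and
conditional bounded inductive theorems. -/

namespace LCSTRS

/-! ### Sorts, types, signatures -/

/-- Sorts: the theory sorts are `int`, `bool` and the members of `T`; the members of `N` are the
sorts that are not theory sorts. -/
inductive Srt (T N : Type) where
  | int
  | bool
  | extra (t : T)
  | other (n : N)

/-- Being a theory sort. -/
def Srt.IsTheory {T N : Type} : Srt T N → Prop
  | .other _ => False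
  | _ => True

/-- Simple types over a set of sorts. -/
inductive Ty (S : Type) where
  | base (ι : S)
  | arr (σ τ : Ty S)

infixr:60 " ⇒ₜ " => Ty.arr

/-- Theory types: `ι₁ → ⋯ → ιₘ → κ` where all of `ι₁, …, ιₘ, κ` are theory sorts. -/
inductive Ty.IsTheory {T N : Type} : Ty (Srt T N) → Prop where
  | base {ι : Srt T N} : ι.IsTheory → Ty.IsTheory (.base ι)
  | arr {ι : Srt T N} {σ : Ty (Srt T N)} :
      ι.IsTheory → Ty.IsTheory σ → Ty.IsTheory (.base ι ⇒ₜ σ)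

/-- Interpretation of sorts. Only the theory sorts matter: no symbol of a type that involves another
sort is ever interpreted. -/
def Srt.sem {T N : Type} (Carrier : T → Type) : Srt T N → Type
  | .int => ℤ
  | .bool => Bool
  | .extra t => Carrier t
  | .other _ => Unit

/-- Interpretation of types: all total functions. -/
def Ty.sem {T N : Type} (Carrier : T → Type) : Ty (Srt T N) → Type
  | .base ι => ι.sem Carrier
  | .arr σ τ => Ty.sem Carrier σ → Ty.sem Carrier τ

/-- The data from which the terms are built. The theory signature consists of the standard symbols on
integers and booleans (see `ThSym`) and of the further symbols `Extra`, each of which has a theory type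
and an interpretation. The symbols `Fn` are those outside the theory signature. Symbols and variables
are given as families indexed by their type, which is the same as a function `typeof`. The
integer literals are the only values of sort `int`. -/
structure Signature where
  /-- theory sorts other than `int` and `bool` -/
  T : Type
  /-- sorts that are not theory sorts -/
  N : Type
  /-- interpretation of the additional theory sorts -/
  Carrier : T → Type
  carrier_nonempty : ∀ t, Nonempty (Carrier t)
  /-- variables of each type -/
  Var : Ty (Srt T N) → Type
  /-- function symbols of each type outside the theory signature -/
  Fn : Ty (Srt T N) → Type
  /-- additional theory symbols of each type -/
  Extra : Ty (Srt T N) → Type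
  extra_isTheory : ∀ {τ}, Extra τ → τ.IsTheory
  extra_int : IsEmpty (Extra (.base .int))
  /-- interpretation of the additional theory symbols -/
  extraSem : ∀ {τ}, Extra τ → τ.sem Carrier

/-- Types over the sorts of a signature. -/
abbrev Signature.Typ (Sg : Signature) : Type := Ty (Srt Sg.T Sg.N)

/-- The type `int`. -/
abbrev tInt {T N : Type} : Ty (Srt T N) := .base .int

/-- The type `bool`. -/
abbrev tBool {T N : Type} : Ty (Srt T N) := .base .bool

/-- The type `int → int → int`. -/
abbrev tOp {T N : Type} : Ty (Srt T N) := tInt ⇒ₜ tInt ⇒ₜ tInt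

/-- The theory symbols. -/
inductive ThSym (Sg : Signature) : Sg.Typ → Type where
  | num (n : ℤ) : ThSym Sg tInt
  | tru : ThSym Sg tBool
  | fls : ThSym Sg tBool
  | add : ThSym Sg (tInt ⇒ₜ tInt ⇒ₜ tInt)
  | sub : ThSym Sg (tInt ⇒ₜ tInt ⇒ₜ tInt)
  | mul : ThSym Sg (tInt ⇒ₜ tInt ⇒ₜ tInt)
  | eq : ThSym Sg (tInt ⇒ₜ tInt ⇒ₜ tBool)
  | lt : ThSym Sg (tInt ⇒ₜ tInt ⇒ₜ tBool)
  | le : ThSym Sg (tInt ⇒ₜ tInt ⇒ₜ tBool)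
  | gt : ThSym Sg (tInt ⇒ₜ tInt ⇒ₜ tBool)
  | ge : ThSym Sg (tInt ⇒ₜ tInt ⇒ₜ tBool)
  | and : ThSym Sg (tBool ⇒ₜ tBool ⇒ₜ tBool)
  | or : ThSym Sg (tBool ⇒ₜ tBool ⇒ₜ tBool)
  | not : ThSym Sg (tBool ⇒ₜ tBool)
  | extra {τ : Sg.Typ} (f : Sg.Extra τ) : ThSym Sg τ

/-- Interpretation of the theory symbols. -/
def ThSym.sem {Sg : Signature} : {τ : Sg.Typ} → ThSym Sg τ → τ.sem Sg.Carrier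
  | _, .num n => n
  | _, .tru => true
  | _, .fls => false
  | _, .add => fun (m n : ℤ) => m + n
  | _, .sub => fun (m n : ℤ) => m - n
  | _, .mul => fun (m n : ℤ) => m * n
  | _, .eq => fun (m n : ℤ) => decide (m = n)
  | _, .lt => fun (m n : ℤ) => decide (m < n)
  | _, .le => fun (m n : ℤ) => decide (m ≤ n)
  | _, .gt => fun (m n : ℤ) => decide (m > n)
  | _, .ge => fun (m n : ℤ) => decide (m ≥ n)
  | _, .and => fun (p q : Bool) => p && q
  | _, .or => fun (p q : Bool) => p || q
  | _, .not => fun (p : Bool) => !p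
  | _, .extra f => Sg.extraSem f

/-! ### Terms -/

/-- Well-typed terms over the signature, the variables and fresh typed constants `H` (the boxes of
contexts and context functions). -/
inductive Tm (Sg : Signature) (H : Sg.Typ → Type) : Sg.Typ → Type where
  | var {τ : Sg.Typ} (x : Sg.Var τ) : Tm Sg H τ
  | th {τ : Sg.Typ} (f : ThSym Sg τ) : Tm Sg H τ
  | fn {τ : Sg.Typ} (f : Sg.Fn τ) : Tm Sg H τ
  | box {τ : Sg.Typ} (h : H τ) : Tm Sg H τ
  | app {σ τ : Sg.Typ} (s : Tm Sg H (σ ⇒ₜ τ)) (t : Tm Sg H σ) : Tm Sg H τ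

/-- No boxes. -/
abbrev NoBox (Sg : Signature) : Sg.Typ → Type := fun _ => Empty

/-- Terms over the signature and the variables. -/
abbrev Term (Sg : Signature) (τ : Sg.Typ) : Type := Tm Sg (NoBox Sg) τ

/-- The set of variables that occur in a term. -/
def Tm.vars {Sg : Signature} {H : Sg.Typ → Type} :
    {τ : Sg.Typ} → Tm Sg H τ → Set (Σ τ : Sg.Typ, Sg.Var τ)
  | _, .var x => {⟨_, x⟩}
  | _, .th _ => ∅
  | _, .fn _ => ∅
  | _, .box _ => ∅
  | _, .app s t => s.vars ∪ t.vars

/-- Replacing the boxes by terms: `C(s₁, …, sₙ)`. -/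
def Tm.fill {Sg : Signature} {H : Sg.Typ → Type} (s : ∀ τ, H τ → Term Sg τ) :
    {τ : Sg.Typ} → Tm Sg H τ → Term Sg τ
  | _, .var x => .var x
  | _, .th f => .th f
  | _, .fn f => .fn f
  | _, .box h => s _ h
  | _, .app u v => .app (u.fill s) (v.fill s)

/-- A term is ground if no variable occurs in it. -/
def Tm.IsGround {Sg : Signature} {H : Sg.Typ → Type} {τ : Sg.Typ} (t : Tm Sg H τ) : Prop :=
  t.vars = ∅

/-- Theory terms: built from theory symbols and variables. -/
def Tm.IsTheory {Sg : Signature} {H : Sg.Typ → Type} : {τ : Sg.Typ} → Tm Sg H τ → Prop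
  | _, .var _ => True
  | _, .th _ => True
  | _, .fn _ => False
  | _, .box _ => False
  | _, .app s t => s.IsTheory ∧ t.IsTheory

/-- The interpretation of a ground theory term; `none` on all other terms. -/
def Tm.eval {Sg : Signature} {H : Sg.Typ → Type} :
    {τ : Sg.Typ} → Tm Sg H τ → Option (τ.sem Sg.Carrier)
  | _, .var _ => none
  | _, .th f => some f.sem
  | _, .fn _ => none
  | _, .box _ => none
  | _, .app s t =>
      match s.eval, t.eval with
      | some f, some a => some (f a)
      | _, _ => none

/-- Values: theory symbols whose type is a sort (necessarily a theory sort). -/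
inductive IsValue {Sg : Signature} : {τ : Sg.Typ} → Term Sg τ → Prop where
  | mk {ι : Srt Sg.T Sg.N} (f : ThSym Sg (.base ι)) : IsValue (.th f)

/-- Constraints: theory terms of type `bool` all of whose variables have a theory sort as type. -/
def IsConstraint {Sg : Signature} (φ : Term Sg tBool) : Prop :=
  φ.IsTheory ∧ ∀ x ∈ φ.vars, ∃ ι : Srt Sg.T Sg.N, ι.IsTheory ∧ x.1 = .base ι

/-- The direct and indirect proper subterms, generated by `s t ▷ s` and `s t ▷ t`. -/
inductive ProperSubterm {Sg : Signature} : {σ τ : Sg.Typ} → Term Sg σ → Term Sg τ → Prop where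
  | head {σ τ : Sg.Typ} (s : Term Sg (σ ⇒ₜ τ)) (t : Term Sg σ) : ProperSubterm (s.app t) s
  | arg {σ τ : Sg.Typ} (s : Term Sg (σ ⇒ₜ τ)) (t : Term Sg σ) : ProperSubterm (s.app t) t
  | trans {ρ σ τ : Sg.Typ} {s : Term Sg ρ} {t : Term Sg σ} {u : Term Sg τ} :
      ProperSubterm s t → ProperSubterm t u → ProperSubterm s u

/-! ### Substitutions and contexts -/

/-- Substitutions are type-preserving. -/
abbrev Subst (Sg : Signature) : Type := ∀ τ : Sg.Typ, Sg.Var τ → Term Sg τ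

/-- Application of a substitution. -/
def Tm.subst {Sg : Signature} (γ : Subst Sg) : {τ : Sg.Typ} → Term Sg τ → Term Sg τ
  | _, .var x => γ _ x
  | _, .th f => .th f
  | _, .fn f => .fn f
  | _, .app s t => .app (Tm.subst γ s) (Tm.subst γ t)

/-- The domain of a substitution. -/
def Subst.dom {Sg : Signature} (γ : Subst Sg) : Set (Σ τ : Sg.Typ, Sg.Var τ) :=
  {x | γ x.1 x.2 ≠ .var x.2}

/-- A substitution is ground if it maps its domain to ground terms. -/
def Subst.IsGround {Sg : Signature} (γ : Subst Sg) : Prop :=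
  ∀ x ∈ γ.dom, (γ x.1 x.2).IsGround

/-- `γ` respects `φ`: it maps the variables of `φ` to values and `φγ` is interpreted as true. -/
def Subst.Respects {Sg : Signature} (γ : Subst Sg) (φ : Term Sg tBool) : Prop :=
  (∀ x ∈ φ.vars, IsValue (γ x.1 x.2)) ∧ (φ.subst γ).eval = some true

/-- Contexts of type `τ` with exactly one occurrence of a box of type `σ`. -/
inductive Ctx (Sg : Signature) (σ : Sg.Typ) : Sg.Typ → Type where
  | hole : Ctx Sg σ σ
  | appL {ρ τ : Sg.Typ} (C : Ctx Sg σ (ρ ⇒ₜ τ)) (t : Term Sg ρ) : Ctx Sg σ τ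
  | appR {ρ τ : Sg.Typ} (s : Term Sg (ρ ⇒ₜ τ)) (C : Ctx Sg σ ρ) : Ctx Sg σ τ

/-- `C[t]`. -/
def Ctx.plug {Sg : Signature} {σ : Sg.Typ} :
    {τ : Sg.Typ} → Ctx Sg σ τ → Term Sg σ → Term Sg τ
  | _, .hole, u => u
  | _, .appL C t, u => .app (C.plug u) t
  | _, .appR s C, u => .app s (C.plug u)

/-- No variable occurs in the context. -/
def Ctx.IsGround {Sg : Signature} {σ : Sg.Typ} : {τ : Sg.Typ} → Ctx Sg σ τ → Prop
  | _, .hole => True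
  | _, .appL C t => C.IsGround ∧ t.IsGround
  | _, .appR s C => s.IsGround ∧ C.IsGround

/-! ### Rules and rewriting -/

/-- A constrained rule `lhs → rhs [constraint]`. -/
structure Rule (Sg : Signature) (τ : Sg.Typ) where
  lhs : Term Sg τ
  rhs : Term Sg τ
  constraint : Term Sg tBool

/-- A set of rules. -/
abbrev RuleSet (Sg : Signature) : Type := ∀ τ : Sg.Typ, Set (Rule Sg τ)

/-- Function symbols of any type. -/
abbrev Sym (Sg : Signature) : Type := Σ τ : Sg.Typ, ThSym Sg τ ⊕ Sg.Fn τ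

/-- The head symbol `f` and the number `n` of arguments of a term `f s₁ ⋯ sₙ`; `none` if the head is a
variable. -/
def Tm.spine {Sg : Signature} : {τ : Sg.Typ} → Term Sg τ → Option (Sym Sg × ℕ)
  | _, .var _ => none
  | _, .th f => some (⟨_, .inl f⟩, 0)
  | _, .fn f => some (⟨_, .inr f⟩, 0)
  | _, .app s _ => s.spine.map fun p => (p.1, p.2 + 1)

/-- The number of arguments that a symbol of the given type can take. -/
def Ty.numArgs {S : Type} : Ty S → ℕ
  | .base _ => 0
  | .arr _ τ => τ.numArgs + 1

/-- There is a rule for `f` with `k` arguments on the left, among the given rules or among the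
calculation rules (which exist for the theory symbols that are not values). The arity of `f` is this
`k` if there is one, and `∞` otherwise. -/
def DefinedWith {Sg : Signature} (R : RuleSet Sg) (f : Sym Sg) (k : ℕ) : Prop :=
  (∃ (τ : Sg.Typ) (ρ : Rule Sg τ), ρ ∈ R τ ∧ ρ.lhs.spine = some (f, k)) ∨
    ∃ (τ : Sg.Typ) (g : ThSym Sg τ), f = ⟨τ, .inl g⟩ ∧ 0 < τ.numArgs ∧ k = τ.numArgs

/-- The requirements on the rules of an LCSTRS: left-hand sides have the form `f ℓ₁ ⋯ ℓₖ` and are not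
theory terms, constraints are constraints, there are no fresh variables on the right other than those of the
constraint, and every function symbol has a unique arity. -/
structure IsLCSTRS {Sg : Signature} (R : RuleSet Sg) : Prop where
  head : ∀ (τ : Sg.Typ), ∀ ρ ∈ R τ, ρ.lhs.spine ≠ none
  notTheory : ∀ (τ : Sg.Typ), ∀ ρ ∈ R τ, ¬ ρ.lhs.IsTheory
  constraint : ∀ (τ : Sg.Typ), ∀ ρ ∈ R τ, IsConstraint ρ.constraint
  vars : ∀ (τ : Sg.Typ), ∀ ρ ∈ R τ, ρ.rhs.vars ⊆ ρ.lhs.vars ∪ ρ.constraint.vars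
  arity : ∀ (f : Sym Sg) (k l : ℕ), DefinedWith R f k → DefinedWith R f l → k = l

/-- A theory symbol applied to values. -/
inductive IsValueApp {Sg : Signature} : {τ : Sg.Typ} → Term Sg τ → Prop where
  | sym {τ : Sg.Typ} (f : ThSym Sg τ) : IsValueApp (.th f)
  | app {σ τ : Sg.Typ} {s : Term Sg (σ ⇒ₜ τ)} {v : Term Sg σ} :
      IsValueApp s → IsValue v → IsValueApp (s.app v)

/-- Root steps. The instances of a calculation rule `f x₁ ⋯ xₘ → y [y = f x₁ ⋯ xₘ]` under the
substitutions that respect its constraint are the pairs of a fully applied `f v₁ ⋯ vₘ`, with `m > 0`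
and values `vᵢ`, and a value with the same interpretation. -/
inductive RootStep {Sg : Signature} (R : RuleSet Sg) :
    {τ : Sg.Typ} → Term Sg τ → Term Sg τ → Prop where
  | rule {τ : Sg.Typ} (ρ : Rule Sg τ) (γ : Subst Sg) :
      ρ ∈ R τ → γ.Respects ρ.constraint → RootStep R (ρ.lhs.subst γ) (ρ.rhs.subst γ)
  | calc {κ : Srt Sg.T Sg.N} (t v : Term Sg (.base κ)) :
      IsValueApp t → ¬ IsValue t → IsValue v → t.eval = v.eval → RootStep R t v

/-- The rewrite relation. -/
def Step {Sg : Signature} (R : RuleSet Sg) {τ : Sg.Typ} (s t : Term Sg τ) : Prop :=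
  ∃ (σ : Sg.Typ) (C : Ctx Sg σ τ) (l r : Term Sg σ),
    RootStep R l r ∧ s = C.plug l ∧ t = C.plug r

/-- A term is a semi-constructor term if in each of its subterms `f s₁ ⋯ sₙ` the number `n` is smaller
than the arity of `f`. -/
def IsSemiConstructor {Sg : Signature} (R : RuleSet Sg) {τ : Sg.Typ} (t : Term Sg τ) : Prop :=
  ∀ (σ : Sg.Typ) (u : Term Sg σ),
    ((⟨σ, u⟩ : Σ ρ : Sg.Typ, Term Sg ρ) = ⟨τ, t⟩ ∨ ProperSubterm t u) →
      ∀ (f : Sym Sg) (n k : ℕ), u.spine = some (f, n) → DefinedWith R f k → n < k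

/-- Quasi-reductivity: irreducible ground terms are semi-constructor terms. -/
def IsQuasiReductive {Sg : Signature} (R : RuleSet Sg) : Prop :=
  ∀ (τ : Sg.Typ) (t : Term Sg τ), t.IsGround → (∀ u, ¬ Step R t u) → IsSemiConstructor R t

/-- The only ground semi-constructor terms of sort `int` are the integer literals. -/
def IntTermsAreValues {Sg : Signature} (R : RuleSet Sg) : Prop :=
  ∀ t : Term Sg tInt, t.IsGround → IsSemiConstructor R t → IsValue t

/-! ### Bounded ground convertibility -/

/-- A relation between terms of arbitrary types. -/
abbrev TermRel (Sg : Signature) : Type :=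
  (Σ τ : Sg.Typ, Term Sg τ) → (Σ τ : Sg.Typ, Term Sg τ) → Prop

/-- A well-founded (strict, transitive) ordering that includes rewriting and the subterm relation. -/
structure IsBoundingOrder {Sg : Signature} (R : RuleSet Sg) (gt : TermRel Sg) : Prop where
  trans : ∀ s t u, gt s t → gt t u → gt s u
  wf : WellFounded fun s t => gt t s
  step : ∀ {τ : Sg.Typ} (s t : Term Sg τ), Step R s t → gt ⟨_, s⟩ ⟨_, t⟩
  subterm : ∀ {σ τ : Sg.Typ} (s : Term Sg σ) (t : Term Sg τ), ProperSubterm s t → gt ⟨_, s⟩ ⟨_, t⟩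

/-- The reflexive closure. -/
def TermRel.ge {Sg : Signature} (gt : TermRel Sg) : TermRel Sg := fun s t => s = t ∨ gt s t

/-- `s ≻ t [φ]`. -/
def GtUnder {Sg : Signature} (gt : TermRel Sg) {σ τ : Sg.Typ}
    (s : Term Sg σ) (t : Term Sg τ) (φ : Term Sg tBool) : Prop :=
  ∀ γ : Subst Sg, γ.IsGround → γ.Respects φ → s.vars ∪ t.vars ⊆ γ.dom →
    gt ⟨_, s.subst γ⟩ ⟨_, t.subst γ⟩

/-- One link `C[s] ↔ C[t]` of a bounded conversion: `C`, `s`, `t` are ground, `s` and `t` are related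
by a rewrite step in one direction, and each of them is dominated by one of the two bounds. -/
def BoundedLink {Sg : Signature} (R : RuleSet Sg) (gt : TermRel Sg) {α β τ : Sg.Typ}
    (b : Term Sg α) (c : Term Sg β) (u v : Term Sg τ) : Prop :=
  ∃ (σ : Sg.Typ) (C : Ctx Sg σ τ) (s t : Term Sg σ),
    C.IsGround ∧ s.IsGround ∧ t.IsGround ∧ u = C.plug s ∧ v = C.plug t ∧
    (Step R s t ∨ Step R t s) ∧
    (gt.ge ⟨_, b⟩ ⟨_, s⟩ ∨ gt.ge ⟨_, c⟩ ⟨_, s⟩) ∧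
    (gt.ge ⟨_, b⟩ ⟨_, t⟩ ∨ gt.ge ⟨_, c⟩ ⟨_, t⟩)

/-- `s ≈ t [φ]` is bounded ground convertible under the bounding terms `b`, `c`: `s = t`, or for every
ground substitution that respects the equation the instances of `s` and `t` are connected by a
sequence of one or more bounded links. -/
def BoundedConvertible {Sg : Signature} (R : RuleSet Sg) (gt : TermRel Sg) {α β τ : Sg.Typ}
    (b : Term Sg α) (c : Term Sg β) (s t : Term Sg τ) (φ : Term Sg tBool) : Prop :=
  s = t ∨ ∀ γ : Subst Sg, γ.IsGround → γ.Respects φ → s.vars ∪ t.vars ⊆ γ.dom →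
    Relation.TransGen (BoundedLink R gt (b.subst γ) (c.subst γ)) (s.subst γ) (t.subst γ)

/-- `s ≈ t [φ]` is an equation (so `φ` is a constraint) and a bounded inductive theorem. -/
def IsBoundedInductiveTheorem {Sg : Signature} (R : RuleSet Sg) (gt : TermRel Sg) {τ : Sg.Typ}
    (s t : Term Sg τ) (φ : Term Sg tBool) : Prop :=
  IsConstraint φ ∧ BoundedConvertible R gt s t s t φ

/-! ### Conditional bounded inductive theorems -/

/-- Context equations `lhs ≈ rhs [constraint]` over the boxes `H`. -/
structure CtxEqn (Sg : Signature) (H : Sg.Typ → Type) where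
  {ty : Sg.Typ}
  lhs : Tm Sg H ty
  rhs : Tm Sg H ty
  constraint : Tm Sg H tBool

/-- Context ordering requirements `lhs ≻ rhs [constraint]` over the boxes `H`. -/
structure CtxReq (Sg : Signature) (H : Sg.Typ → Type) where
  {tyL : Sg.Typ}
  {tyR : Sg.Typ}
  lhs : Tm Sg H tyL
  rhs : Tm Sg H tyR
  constraint : Tm Sg H tBool

/-- The variables of a context equation. -/
def CtxEqn.vars {Sg : Signature} {H : Sg.Typ → Type} (e : CtxEqn Sg H) :
    Set (Σ τ : Sg.Typ, Sg.Var τ) :=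
  e.lhs.vars ∪ e.rhs.vars ∪ e.constraint.vars

/-- The variables of a context ordering requirement. -/
def CtxReq.vars {Sg : Signature} {H : Sg.Typ → Type} (o : CtxReq Sg H) :
    Set (Σ τ : Sg.Typ, Sg.Var τ) :=
  o.lhs.vars ∪ o.rhs.vars ∪ o.constraint.vars

/-- The instance of the context equation `e` is a bounded inductive theorem. -/
def CtxEqn.Holds {Sg : Signature} {H : Sg.Typ → Type} (R : RuleSet Sg) (gt : TermRel Sg)
    (s : ∀ τ, H τ → Term Sg τ) (e : CtxEqn Sg H) : Prop :=
  IsBoundedInductiveTheorem R gt (e.lhs.fill s) (e.rhs.fill s) (e.constraint.fill s)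

/-- The instance of the context ordering requirement `o` holds. -/
def CtxReq.Holds {Sg : Signature} {H : Sg.Typ → Type} (gt : TermRel Sg)
    (s : ∀ τ, H τ → Term Sg τ) (o : CtxReq Sg H) : Prop :=
  GtUnder gt (o.lhs.fill s) (o.rhs.fill s) (o.constraint.fill s)

/-- `A ⊢ E if O` is a conditional bounded inductive theorem. The terms that replace the boxes range over
all terms of the appropriate types in which the variables of `A`, `E`, `O` do not occur (so that no
variable is captured). -/
def IsCondBoundedInductiveTheorem {Sg : Signature} {H : Sg.Typ → Type} (R : RuleSet Sg)
    (gt : TermRel Sg) (A E : Set (CtxEqn Sg H)) (O : Set (CtxReq Sg H)) : Prop :=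
  ∀ s : ∀ τ, H τ → Term Sg τ,
    (∀ τ (h : H τ), (∀ e ∈ A ∪ E, Disjoint (s τ h).vars e.vars) ∧
      ∀ o ∈ O, Disjoint (s τ h).vars o.vars) →
    (∀ e ∈ A, e.Holds R gt s) → (∀ o ∈ O, o.Holds gt s) → ∀ e ∈ E, e.Holds R gt s

/-! ### Term notation -/

section Notation

variable {Sg : Signature} {H : Sg.Typ → Type}

/-- `f s t`. -/
abbrev Tm.app₂ {ρ σ τ : Sg.Typ} (f : Tm Sg H (ρ ⇒ₜ σ ⇒ₜ τ)) (s : Tm Sg H ρ) (t : Tm Sg H σ) :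
    Tm Sg H τ := (f.app s).app t

/-- The integer literal `n`. -/
abbrev lit (n : ℤ) : Tm Sg H tInt := .th (.num n)

/-- The constraint `true`. -/
abbrev tt : Tm Sg H tBool := .th .tru

end Notation

infixl:65 " +ₜ " => Tm.app₂ (Tm.th ThSym.add)
infixl:65 " -ₜ " => Tm.app₂ (Tm.th ThSym.sub)
infix:50 " =ₜ " => Tm.app₂ (Tm.th ThSym.eq)
infix:50 " <ₜ " => Tm.app₂ (Tm.th ThSym.lt)
infix:50 " ≤ₜ " => Tm.app₂ (Tm.th ThSym.le)
infix:50 " >ₜ " => Tm.app₂ (Tm.th ThSym.gt)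
infix:50 " ≥ₜ " => Tm.app₂ (Tm.th ThSym.ge)
infixr:35 " ∧ₜ " => Tm.app₂ (Tm.th ThSym.and)

/-! ### The recursors -/

/-- The type of the four recursors. -/
abbrev tRec {T N : Type} : Ty (Srt T N) := tOp ⇒ₜ tInt ⇒ₜ tInt ⇒ₜ tInt ⇒ₜ tInt

/-- The four recursor symbols. -/
structure Recursors (Sg : Signature) where
  tailupSym : Sg.Fn tRec
  taildnSym : Sg.Fn tRec
  recupSym : Sg.Fn tRec
  recdnSym : Sg.Fn tRec

section Rec

variable {Sg : Signature} {H : Sg.Typ → Type} (r : Recursors Sg)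
  (f : Tm Sg H tOp) (i j a : Tm Sg H tInt)

/-- `tailup f i j a`. -/
abbrev Recursors.tailup : Tm Sg H tInt := ((((Tm.fn r.tailupSym).app f).app i).app j).app a

/-- `taildn f i j a`. -/
abbrev Recursors.taildn : Tm Sg H tInt := ((((Tm.fn r.taildnSym).app f).app i).app j).app a

/-- `recup f i j a`. -/
abbrev Recursors.recup : Tm Sg H tInt := ((((Tm.fn r.recupSym).app f).app i).app j).app a

/-- `recdn f i j a`. -/
abbrev Recursors.recdn : Tm Sg H tInt := ((((Tm.fn r.recdnSym).app f).app i).app j).app a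

end Rec

/-- The eight recursor rules, written with the variables `f`, `i`, `x`, `y`, `z`, `a`. -/
def recRules {Sg : Signature} (r : Recursors Sg) (f : Term Sg tOp) (i x y z a : Term Sg tInt) :
    Set (Rule Sg tInt) :=
  { ⟨r.tailup f i y a, a, i >ₜ y⟩,
    ⟨r.tailup f i y a, r.tailup f (i +ₜ lit 1) y (f.app₂ i a), i ≤ₜ y⟩,
    ⟨r.taildn f x i a, a, i <ₜ x⟩,
    ⟨r.taildn f x i a, r.taildn f x (i -ₜ lit 1) (f.app₂ a i), i ≥ₜ x⟩,
    ⟨r.recup f i y z, z, i >ₜ y⟩,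
    ⟨r.recup f i y z, f.app₂ (r.recup f (i +ₜ lit 1) y z) i, i ≤ₜ y⟩,
    ⟨r.recdn f x i z, z, i <ₜ x⟩,
    ⟨r.recdn f x i z, f.app₂ i (r.recdn f x (i -ₜ lit 1) z), i ≥ₜ x⟩ }

/-- The recursor rules, written with some pairwise distinct variables, are among the rules. -/
def IncludesRecursors {Sg : Signature} (R : RuleSet Sg) (r : Recursors Sg) : Prop :=
  ∃ (f : Sg.Var tOp) (i x y z a : Sg.Var tInt), [i, x, y, z, a].Nodup ∧
    recRules r (.var f) (.var i) (.var x) (.var y) (.var z) (.var a) ⊆ R tInt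

/-- Two boxes of type `int → int → int`. -/
inductive TwoOps {T N : Type} : Ty (Srt T N) → Type where
  | one : TwoOps tOp
  | two : TwoOps tOp

/-- `□₁ s t`, where `□₁ :: int → int → int`. -/
abbrev box₁ {Sg : Signature} (s t : Tm Sg TwoOps tInt) : Tm Sg TwoOps tInt :=
  Tm.app₂ (.box .one) s t

/-- `□₂ s t`, where `□₂ :: int → int → int`. -/
abbrev box₂ {Sg : Signature} (s t : Tm Sg TwoOps tInt) : Tm Sg TwoOps tInt :=
  Tm.app₂ (.box .two) s t

notation "□₁" => Tm.box TwoOps.one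
notation "□₂" => Tm.box TwoOps.two

/-- A variable as a context function. -/
abbrev v {Sg : Signature} (x : Sg.Var tInt) : Tm Sg TwoOps tInt := .var x

end LCSTRS

open LCSTRS

namespace LCSTRS

variable {Sg : Signature}

/-! ### Ground terms and substitutions -/

section Ground

variable {H : Sg.Typ → Type}

/-! Fix a ground substitution and let `F`, `G` be the resulting instances of the two boxes. Ground
terms of type `int` reduce to literals (`exists_reduces_lit`), so the two range arguments of a
recursor may be taken to be literals `m`, `n` (`BConv.of_lits`), while the last argument stays an
arbitrary ground term `A`. Each claim is then an induction on the number of remaining iterations: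
unfold the left recursor once, apply the induction hypothesis, and close the gap by an auxiliary
conversion, itself proved by induction from the algebraic laws: `taildn_shift`: `taildn G m n B`
against `taildn G (m+1) n (F m B)`; `recdn_shift`: `recdn F m n (G A k)` against `F k (recdn F m n
A)`; `recup_shift`: `recup F m n (G k A)` against `F (recup F m n A) k`; `recdn_extend`: `F (recdn G
(m+1) n A) m` against `recdn G m n A`.

Bounds are handled by predicates `P` that are closed downwards under the ordering. `BConv` asks for
a conversion inside every such `P` that contains both ends. For a fixed `P` these conversions
compose, and the only thing to check is that the junction terms lie in `P`. Most of them are reducts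
or subterms of terms already in `P`. In each claim two are not obtained that way, one in the main
induction and one in the auxiliary one; they are the right-hand sides of the two ordering
requirements.

The hypotheses speak about variables that the goal's substitution also assigns. `CtxReq.Holds.inst`
and `CtxEqn.Holds.inst` reassign these variables without disturbing the terms in the boxes. -/

@[simp] theorem Tm.isGround_app {σ τ : Sg.Typ} {s : Tm Sg H (σ ⇒ₜ τ)} {t : Tm Sg H σ} :
    (s.app t).IsGround ↔ s.IsGround ∧ t.IsGround := by
  simp [Tm.IsGround, Tm.vars]

@[simp] theorem Tm.isGround_th {τ : Sg.Typ} (f : ThSym Sg τ) : (Tm.th f : Tm Sg H τ).IsGround :=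
  rfl

@[simp] theorem Tm.isGround_fn {τ : Sg.Typ} (f : Sg.Fn τ) : (Tm.fn f : Tm Sg H τ).IsGround :=
  rfl

end Ground

theorem Tm.IsGround.ne_var {τ : Sg.Typ} {t : Term Sg τ} (h : t.IsGround) (x : Sg.Var τ) :
    t ≠ .var x := by
  rintro rfl
  exact Set.singleton_ne_empty _ h

theorem IsValue.isGround {τ : Sg.Typ} {t : Term Sg τ} (h : IsValue t) : t.IsGround := by
  cases h
  rfl

theorem IsValue.exists_lit {t : Term Sg tInt} (h : IsValue t) : ∃ n : ℤ, t = lit n := by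
  cases h with
  | mk f =>
    cases f with
    | num n => exact ⟨n, rfl⟩
    | extra f => exact (Sg.extra_int.false f).elim

theorem isValue_lit (n : ℤ) : IsValue (lit n : Term Sg tInt) := .mk _

theorem Tm.isGround_subst_iff {τ : Sg.Typ} (γ : Subst Sg) (t : Term Sg τ) :
    (t.subst γ).IsGround ↔ ∀ x ∈ t.vars, (γ x.1 x.2).IsGround := by
  induction t with
  | var x => simp [Tm.subst, Tm.vars]
  | th f => simp [Tm.subst, Tm.vars]
  | fn f => simp [Tm.subst, Tm.vars]
  | box h => exact h.elim
  | app s t ihs iht =>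
    simp only [Tm.subst, Tm.isGround_app, ihs, iht, Tm.vars, Set.mem_union, or_imp, forall_and]

theorem Subst.IsGround.isGround_subst {γ : Subst Sg} (hγ : γ.IsGround) {τ : Sg.Typ}
    {t : Term Sg τ} (ht : t.vars ⊆ γ.dom) : (t.subst γ).IsGround :=
  (Tm.isGround_subst_iff γ t).2 fun _ hx => hγ _ (ht hx)

theorem Tm.subst_congr {τ : Sg.Typ} {γ δ : Subst Sg} (t : Term Sg τ)
    (h : ∀ x ∈ t.vars, γ x.1 x.2 = δ x.1 x.2) : t.subst γ = t.subst δ := by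
  induction t with
  | var x => exact h ⟨_, x⟩ rfl
  | th f => rfl
  | fn f => rfl
  | box b => exact b.elim
  | app s t ihs iht =>
    simp only [Tm.subst]
    rw [ihs fun x hx => h x (Or.inl hx), iht fun x hx => h x (Or.inr hx)]

theorem Ctx.isGround_plug_iff {σ τ : Sg.Typ} (C : Ctx Sg σ τ) (t : Term Sg σ) :
    (C.plug t).IsGround ↔ C.IsGround ∧ t.IsGround := by
  induction C with
  | hole => simp [Ctx.plug, Ctx.IsGround]
  | appL C u ih => simp only [Ctx.plug, Ctx.IsGround, Tm.isGround_app, ih]; tauto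
  | appR u C ih => simp only [Ctx.plug, Ctx.IsGround, Tm.isGround_app, ih]; tauto

/-! ### Rewrite steps -/

section Steps

variable {R : RuleSet Sg}

theorem RootStep.step {τ : Sg.Typ} {s t : Term Sg τ} (h : RootStep R s t) : Step R s t :=
  ⟨_, .hole, s, t, h, rfl, rfl⟩

theorem Step.appL {σ τ : Sg.Typ} {s s' : Term Sg (σ ⇒ₜ τ)} (h : Step R s s') (t : Term Sg σ) :
    Step R (s.app t) (s'.app t) := by
  obtain ⟨ρ, C, l, r, hlr, rfl, rfl⟩ := h
  exact ⟨ρ, .appL C t, l, r, hlr, rfl, rfl⟩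

theorem Step.appR {σ τ : Sg.Typ} (s : Term Sg (σ ⇒ₜ τ)) {t t' : Term Sg σ} (h : Step R t t') :
    Step R (s.app t) (s.app t') := by
  obtain ⟨ρ, C, l, r, hlr, rfl, rfl⟩ := h
  exact ⟨ρ, .appR s C, l, r, hlr, rfl, rfl⟩

/-- A variable that is fresh on the right of a rule occurs in the constraint, so a respecting
substitution sends it to a value, which is ground. -/
theorem RootStep.isGround (hR : IsLCSTRS R) {τ : Sg.Typ} {s t : Term Sg τ} (h : RootStep R s t)
    (hs : s.IsGround) : t.IsGround := by
  rcases h with ⟨ρ, γ, hρ, hγ⟩ | ⟨_, _, _, _, hv, _⟩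
  · rw [Tm.isGround_subst_iff] at hs ⊢
    intro x hx
    rcases hR.vars _ ρ hρ hx with hx | hx
    · exact hs x hx
    · exact (hγ.1 x hx).isGround
  · exact hv.isGround

theorem Step.isGround (hR : IsLCSTRS R) {τ : Sg.Typ} {s t : Term Sg τ} (h : Step R s t)
    (hs : s.IsGround) : t.IsGround := by
  obtain ⟨ρ, C, l, r, hlr, rfl, rfl⟩ := h
  rw [Ctx.isGround_plug_iff] at hs ⊢
  exact ⟨hs.1, hlr.isGround hR hs.2⟩

/-- One or more rewrite steps. -/
abbrev Steps (R : RuleSet Sg) {τ : Sg.Typ} : Term Sg τ → Term Sg τ → Prop :=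
  Relation.TransGen (Step R)

theorem Steps.appL {σ τ : Sg.Typ} {s s' : Term Sg (σ ⇒ₜ τ)} (h : Steps R s s') (t : Term Sg σ) :
    Steps R (s.app t) (s'.app t) :=
  h.lift (fun u => u.app t) fun _ _ h => h.appL t

theorem Steps.appR {σ τ : Sg.Typ} (s : Term Sg (σ ⇒ₜ τ)) {t t' : Term Sg σ} (h : Steps R t t') :
    Steps R (s.app t) (s.app t') :=
  h.lift (fun u => s.app u) fun _ _ h => h.appR s

theorem Steps.isGround (hR : IsLCSTRS R) {τ : Sg.Typ} {s t : Term Sg τ} (h : Steps R s t)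
    (hs : s.IsGround) : t.IsGround := by
  induction h with
  | single h => exact h.isGround hR hs
  | tail _ h ih => exact h.isGround hR ih

theorem step_add (m n : ℤ) : Step R (lit m +ₜ lit n) (lit (m + n)) :=
  (RootStep.calc _ _ (.app (.app (.sym _) (isValue_lit m)) (isValue_lit n)) nofun
    (isValue_lit _) rfl).step

theorem step_sub (m n : ℤ) : Step R (lit m -ₜ lit n) (lit (m - n)) :=
  (RootStep.calc _ _ (.app (.app (.sym _) (isValue_lit m)) (isValue_lit n)) nofun
    (isValue_lit _) rfl).step

theorem exists_step_of_not_isValue (hqr : IsQuasiReductive R) (hint : IntTermsAreValues R)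
    {t : Term Sg tInt} (ht : t.IsGround) (hv : ¬ IsValue t) : ∃ u, Step R t u := by
  by_contra h
  exact hv (hint t ht (hqr _ t ht (not_exists.1 h)))

end Steps

/-! ### Steps of the recursors -/

section RecursorSteps

variable {R : RuleSet Sg} {r : Recursors Sg}

open Classical in
/-- A substitution for the variables of type `int`. -/
noncomputable def intSubst (g : Sg.Var tInt → Term Sg tInt) : Subst Sg :=
  Function.update (fun _ x => .var x) tInt g

open Classical in
/-- A substitution for the variables of types `int → int → int` and `int`. -/
noncomputable def recSubst (F : Term Sg tOp) (g : Sg.Var tInt → Term Sg tInt) : Subst Sg :=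
  Function.update (intSubst g) tOp fun _ => F

@[simp] theorem intSubst_int (g : Sg.Var tInt → Term Sg tInt) (x : Sg.Var tInt) :
    intSubst g tInt x = g x := by
  simp [intSubst]

@[simp] theorem recSubst_op (F : Term Sg tOp) (g : Sg.Var tInt → Term Sg tInt)
    (x : Sg.Var tOp) : recSubst F g tOp x = F := by
  simp [recSubst]

@[simp] theorem recSubst_int (F : Term Sg tOp) (g : Sg.Var tInt → Term Sg tInt)
    (x : Sg.Var tInt) : recSubst F g tInt x = g x := by
  simp [recSubst]

theorem respects_compare (c : ThSym Sg (tInt ⇒ₜ tInt ⇒ₜ tBool)) (γ : Subst Sg)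
    {i j : Sg.Var tInt} {m n : ℤ} (hi : γ tInt i = lit m) (hj : γ tInt j = lit n)
    (h : (c.sem : ℤ → ℤ → Bool) m n = true) :
    γ.Respects (Tm.app₂ (.th c) (.var i) (.var j)) := by
  constructor
  · simp [Tm.vars, hi, hj, isValue_lit]
  · simp only [Tm.subst, hi, hj, Tm.eval]
    exact congrArg some h

/-- Instances of the recursor rules under substitutions that respect the constraint. -/
theorem IncludesRecursors.rules (hrec : IncludesRecursors R r) (F : Term Sg tOp) (m n : ℤ)
    (A : Term Sg tInt) :
    (n < m →
      Step R (r.tailup F (lit m) (lit n) A) A ∧ Step R (r.taildn F (lit m) (lit n) A) A ∧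
      Step R (r.recup F (lit m) (lit n) A) A ∧ Step R (r.recdn F (lit m) (lit n) A) A) ∧
    (m ≤ n →
      Step R (r.tailup F (lit m) (lit n) A)
        (r.tailup F (lit m +ₜ lit 1) (lit n) (F.app₂ (lit m) A)) ∧
      Step R (r.taildn F (lit m) (lit n) A)
        (r.taildn F (lit m) (lit n -ₜ lit 1) (F.app₂ A (lit n))) ∧
      Step R (r.recup F (lit m) (lit n) A)
        (F.app₂ (r.recup F (lit m +ₜ lit 1) (lit n) A) (lit m)) ∧
      Step R (r.recdn F (lit m) (lit n) A)
        (F.app₂ (lit n) (r.recdn F (lit m) (lit n -ₜ lit 1) A))) := by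
  classical
  obtain ⟨f, i, x, y, z, a, hnd, hsub⟩ := hrec
  simp only [List.nodup_cons, List.mem_cons, List.not_mem_nil, or_false, not_or, List.nodup_nil,
    and_true, not_false_eq_true] at hnd
  obtain ⟨⟨hix, hiy, hiz, hia⟩, ⟨hxy, hxz, hxa⟩, ⟨hyz, hya⟩, hza⟩ := hnd
  have key : ∀ ρ ∈ recRules r (.var f) (.var i) (.var x) (.var y) (.var z) (.var a),
      ∀ γ : Subst Sg, γ.Respects ρ.constraint → Step R (ρ.lhs.subst γ) (ρ.rhs.subst γ) :=
    fun ρ hρ γ hγ => (RootStep.rule ρ γ (hsub hρ) hγ).step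
  simp only [recRules, Set.mem_insert_iff, Set.mem_singleton_iff, forall_eq_or_imp,
    forall_eq] at key
  obtain ⟨k₁, k₂, k₃, k₄, k₅, k₆, k₇, k₈⟩ := key
  -- The upward recursors run `i` from `m` to the fixed bound `y`; the downward ones run `i` from
  -- `n` to the fixed bound `x`. Hence `i` is `m` in one assignment and `n` in the other. The
  -- default branch serves both `z` and `a`.
  let gup : Sg.Var tInt → Term Sg tInt := fun w =>
    if w = i then lit m else if w = y then lit n else A
  let gdn : Sg.Var tInt → Term Sg tInt := fun w =>
    if w = x then lit m else if w = i then lit n else A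
  have ui : gup i = lit m := by simp [gup]
  have uy : gup y = lit n := by simp [gup, Ne.symm hiy]
  have uz : gup z = A := by simp [gup, Ne.symm hiz, Ne.symm hyz]
  have ua : gup a = A := by simp [gup, Ne.symm hia, Ne.symm hya]
  have dx : gdn x = lit m := by simp [gdn]
  have di : gdn i = lit n := by simp [gdn, hix]
  have dz : gdn z = A := by simp [gdn, Ne.symm hiz, Ne.symm hxz]
  have da : gdn a = A := by simp [gdn, Ne.symm hia, Ne.symm hxa]
  refine ⟨fun h => ⟨?_, ?_, ?_, ?_⟩, fun h => ⟨?_, ?_, ?_, ?_⟩⟩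
  · simpa [Tm.subst, ui, uy, ua] using k₁ (recSubst F gup)
      (respects_compare _ _ (by simpa using ui) (by simpa using uy) (decide_eq_true h))
  · simpa [Tm.subst, dx, di, da] using k₃ (recSubst F gdn)
      (respects_compare _ _ (by simpa using di) (by simpa using dx) (decide_eq_true h))
  · simpa [Tm.subst, ui, uy, uz] using k₅ (recSubst F gup)
      (respects_compare _ _ (by simpa using ui) (by simpa using uy) (decide_eq_true h))
  · simpa [Tm.subst, dx, di, dz] using k₇ (recSubst F gdn)
      (respects_compare _ _ (by simpa using di) (by simpa using dx) (decide_eq_true h))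
  · simpa [Tm.subst, ui, uy, ua] using k₂ (recSubst F gup)
      (respects_compare _ _ (by simpa using ui) (by simpa using uy) (decide_eq_true h))
  · simpa [Tm.subst, dx, di, da] using k₄ (recSubst F gdn)
      (respects_compare _ _ (by simpa using di) (by simpa using dx) (decide_eq_true h))
  · simpa [Tm.subst, ui, uy, uz] using k₆ (recSubst F gup)
      (respects_compare _ _ (by simpa using ui) (by simpa using uy) (decide_eq_true h))
  · simpa [Tm.subst, dx, di, dz] using k₈ (recSubst F gdn)
      (respects_compare _ _ (by simpa using di) (by simpa using dx) (decide_eq_true h))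

theorem tailup_base (hrec : IncludesRecursors R r) (F : Term Sg tOp) {m n : ℤ} (h : n < m)
    (A : Term Sg tInt) : Steps R (r.tailup F (lit m) (lit n) A) A :=
  .single ((hrec.rules F m n A).1 h).1

theorem taildn_base (hrec : IncludesRecursors R r) (F : Term Sg tOp) {m n : ℤ} (h : n < m)
    (A : Term Sg tInt) : Steps R (r.taildn F (lit m) (lit n) A) A :=
  .single ((hrec.rules F m n A).1 h).2.1

theorem recup_base (hrec : IncludesRecursors R r) (F : Term Sg tOp) {m n : ℤ} (h : n < m)
    (A : Term Sg tInt) : Steps R (r.recup F (lit m) (lit n) A) A :=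
  .single ((hrec.rules F m n A).1 h).2.2.1

theorem recdn_base (hrec : IncludesRecursors R r) (F : Term Sg tOp) {m n : ℤ} (h : n < m)
    (A : Term Sg tInt) : Steps R (r.recdn F (lit m) (lit n) A) A :=
  .single ((hrec.rules F m n A).1 h).2.2.2

/-- The rule leaves the redex `m + 1` in the counter; a calculation step turns it into a literal, so
that inductions over integers can continue. The three lemmas below work alike. -/
theorem tailup_unfold (hrec : IncludesRecursors R r) (F : Term Sg tOp) {m n k : ℤ} (h : m ≤ n)
    (hk : k = m + 1) (A : Term Sg tInt) :
    Steps R (r.tailup F (lit m) (lit n) A) (r.tailup F (lit k) (lit n) (F.app₂ (lit m) A)) := by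
  subst hk
  exact .tail (.single ((hrec.rules F m n A).2 h).1) ((((step_add m 1).appR _).appL _).appL _)

theorem taildn_unfold (hrec : IncludesRecursors R r) (F : Term Sg tOp) {m n k : ℤ} (h : m ≤ n)
    (hk : k = n - 1) (A : Term Sg tInt) :
    Steps R (r.taildn F (lit m) (lit n) A) (r.taildn F (lit m) (lit k) (F.app₂ A (lit n))) := by
  subst hk
  exact .tail (.single ((hrec.rules F m n A).2 h).2.1) (((step_sub n 1).appR _).appL _)

theorem recup_unfold (hrec : IncludesRecursors R r) (F : Term Sg tOp) {m n k : ℤ} (h : m ≤ n)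
    (hk : k = m + 1) (A : Term Sg tInt) :
    Steps R (r.recup F (lit m) (lit n) A) (F.app₂ (r.recup F (lit k) (lit n) A) (lit m)) := by
  subst hk
  exact .tail (.single ((hrec.rules F m n A).2 h).2.2.1)
    ((((((step_add m 1).appR _).appL _).appL _).appR _).appL _)

theorem recdn_unfold (hrec : IncludesRecursors R r) (F : Term Sg tOp) {m n k : ℤ} (h : m ≤ n)
    (hk : k = n - 1) (A : Term Sg tInt) :
    Steps R (r.recdn F (lit m) (lit n) A) (F.app₂ (lit n) (r.recdn F (lit m) (lit k) A)) := by
  subst hk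
  exact .tail (.single ((hrec.rules F m n A).2 h).2.2.2)
    ((((step_sub n 1).appR _).appL _).appR _)

end RecursorSteps

/-! ### Conversions below a bound -/

section Conv

variable {R : RuleSet Sg} {gt : TermRel Sg}

/-- Predicates on terms. -/
abbrev TermPred (Sg : Signature) : Type := (Σ τ : Sg.Typ, Term Sg τ) → Prop

/-- Being closed downwards under an ordering. -/
def IsDownClosed (gt : TermRel Sg) (P : TermPred Sg) : Prop :=
  ∀ u w, P u → gt u w → P w

/-- A rewrite step in one direction between ground subterms that satisfy `P`. -/
def Link (R : RuleSet Sg) (P : TermPred Sg) {τ : Sg.Typ} (u w : Term Sg τ) : Prop :=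
  ∃ (σ : Sg.Typ) (C : Ctx Sg σ τ) (s t : Term Sg σ),
    C.IsGround ∧ s.IsGround ∧ t.IsGround ∧ u = C.plug s ∧ w = C.plug t ∧
    (Step R s t ∨ Step R t s) ∧ P ⟨_, s⟩ ∧ P ⟨_, t⟩

/-- Conversion by links below `P`. -/
def Conv (R : RuleSet Sg) (P : TermPred Sg) {τ : Sg.Typ} : Term Sg τ → Term Sg τ → Prop :=
  Relation.ReflTransGen (Link R P)

/-- Conversion below the two terms themselves. -/
def BConv (R : RuleSet Sg) (gt : TermRel Sg) {τ : Sg.Typ} (u w : Term Sg τ) : Prop :=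
  ∀ P : TermPred Sg, IsDownClosed gt P → P ⟨_, u⟩ → P ⟨_, w⟩ → Conv R P u w

variable {P : TermPred Sg}

theorem Link.symm {τ : Sg.Typ} {u w : Term Sg τ} (h : Link R P u w) : Link R P w u := by
  obtain ⟨σ, C, s, t, hC, hs, ht, hu, hw, hst, hPs, hPt⟩ := h
  exact ⟨σ, C, t, s, hC, ht, hs, hw, hu, hst.symm, hPt, hPs⟩

theorem Conv.trans {τ : Sg.Typ} {u w z : Term Sg τ} (h : Conv R P u w) (h' : Conv R P w z) :
    Conv R P u z :=
  Relation.ReflTransGen.trans h h'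

theorem Conv.symm {τ : Sg.Typ} {u w : Term Sg τ} (h : Conv R P u w) : Conv R P w u := by
  induction h with
  | refl => exact .refl
  | tail _ h ih => exact .head h.symm ih

/-- A link bounds only the rewritten subterms, not the context around them, so the same `P` serves
after a ground context is added. -/
theorem Conv.appL {σ τ : Sg.Typ} {s s' : Term Sg (σ ⇒ₜ τ)} (h : Conv R P s s') {t : Term Sg σ}
    (ht : t.IsGround) : Conv R P (s.app t) (s'.app t) := by
  refine Relation.ReflTransGen.lift (fun u : Term Sg (σ ⇒ₜ τ) => u.app t) ?_ _ _ h
  rintro _ _ ⟨ρ, C, l, r, hC, hl, hr, rfl, rfl, h⟩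
  exact ⟨ρ, .appL C t, l, r, ⟨hC, ht⟩, hl, hr, rfl, rfl, h⟩

theorem Conv.appR {σ τ : Sg.Typ} {s : Term Sg (σ ⇒ₜ τ)} (hs : s.IsGround) {t t' : Term Sg σ}
    (h : Conv R P t t') : Conv R P (s.app t) (s.app t') := by
  refine Relation.ReflTransGen.lift (fun u => s.app u) ?_ _ _ h
  rintro _ _ ⟨ρ, C, l, r, hC, hl, hr, rfl, rfl, h⟩
  exact ⟨ρ, .appR s C, l, r, ⟨hs, hC⟩, hl, hr, rfl, rfl, h⟩

theorem IsBoundingOrder.arg_lt (hgt : IsBoundingOrder R gt) {σ τ : Sg.Typ}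
    (s : Term Sg (σ ⇒ₜ τ)) (t : Term Sg σ) : gt ⟨_, s.app t⟩ ⟨_, t⟩ :=
  hgt.subterm _ _ (.arg s t)

theorem IsBoundingOrder.head_lt (hgt : IsBoundingOrder R gt) {σ τ : Sg.Typ}
    (s : Term Sg (σ ⇒ₜ τ)) (t : Term Sg σ) : gt ⟨_, s.app t⟩ ⟨_, s⟩ :=
  hgt.subterm _ _ (.head s t)

theorem IsDownClosed.arg (hP : IsDownClosed gt P) (hgt : IsBoundingOrder R gt) {σ τ : Sg.Typ}
    {s : Term Sg (σ ⇒ₜ τ)} {t : Term Sg σ} (h : P ⟨_, s.app t⟩) : P ⟨_, t⟩ :=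
  hP _ _ h (hgt.arg_lt s t)

theorem IsDownClosed.head (hP : IsDownClosed gt P) (hgt : IsBoundingOrder R gt) {σ τ : Sg.Typ}
    {s : Term Sg (σ ⇒ₜ τ)} {t : Term Sg σ} (h : P ⟨_, s.app t⟩) : P ⟨_, s⟩ :=
  hP _ _ h (hgt.head_lt s t)

theorem IsDownClosed.steps (hP : IsDownClosed gt P) (hgt : IsBoundingOrder R gt) {τ : Sg.Typ}
    {s t : Term Sg τ} (hst : Steps R s t) (h : P ⟨_, s⟩) : P ⟨_, t⟩ := by
  induction hst with
  | single hst => exact hP _ _ h (hgt.step _ _ hst)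
  | tail _ hst ih => exact hP _ _ ih (hgt.step _ _ hst)

/-- Rewriting decreases the term, so only its source has to be known to lie in `P`. -/
theorem Link.of_step (hR : IsLCSTRS R) (hgt : IsBoundingOrder R gt) (hP : IsDownClosed gt P)
    {τ : Sg.Typ} {s t : Term Sg τ} (hst : Step R s t) (hs : s.IsGround) (h : P ⟨_, s⟩) :
    Link R P s t :=
  ⟨_, .hole, s, t, trivial, hs, hst.isGround hR hs, rfl, rfl, .inl hst, h,
    hP _ _ h (hgt.step _ _ hst)⟩

theorem Conv.of_steps (hR : IsLCSTRS R) (hgt : IsBoundingOrder R gt) (hP : IsDownClosed gt P)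
    {τ : Sg.Typ} {s t : Term Sg τ} (hst : Steps R s t) (hs : s.IsGround) (h : P ⟨_, s⟩) :
    Conv R P s t := by
  induction hst with
  | single hst => exact .single (.of_step hR hgt hP hst hs h)
  | tail hst hst' ih =>
    exact .tail ih (.of_step hR hgt hP hst' (Steps.isGround hR hst hs) (hP.steps hgt hst h))

theorem Conv.of_reduces (hR : IsLCSTRS R) (hgt : IsBoundingOrder R gt) (hP : IsDownClosed gt P)
    {τ : Sg.Typ} {s t : Term Sg τ} (hst : Relation.ReflTransGen (Step R) s t) (hs : s.IsGround)
    (h : P ⟨_, s⟩) : Conv R P s t ∧ P ⟨_, t⟩ := by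
  rcases Relation.reflTransGen_iff_eq_or_transGen.1 hst with rfl | hst
  · exact ⟨.refl, h⟩
  · exact ⟨.of_steps hR hgt hP hst hs h, hP.steps hgt hst h⟩

/-- Ground terms of type `int` reduce to literals. -/
theorem exists_reduces_lit (hR : IsLCSTRS R) (hqr : IsQuasiReductive R)
    (hint : IntTermsAreValues R) (hgt : IsBoundingOrder R gt) (t : Term Sg tInt)
    (ht : t.IsGround) : ∃ n : ℤ, Relation.ReflTransGen (Step R) t (lit n) := by
  -- The ordering compares terms of all types, so the well-founded induction has to run over pairs
  -- of a type and a term.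
  suffices H : ∀ T : Σ τ : Sg.Typ, Term Sg τ, ∀ t : Term Sg tInt, T = ⟨_, t⟩ → t.IsGround →
      ∃ n : ℤ, Relation.ReflTransGen (Step R) t (lit n) from H _ t rfl ht
  intro T
  induction T using hgt.wf.induction with
  | h T ih =>
    rintro t rfl ht
    by_cases hv : IsValue t
    · obtain ⟨n, rfl⟩ := hv.exists_lit
      exact ⟨n, .refl⟩
    · obtain ⟨u, hu⟩ := exists_step_of_not_isValue hqr hint ht hv
      obtain ⟨n, hn⟩ := ih _ (hgt.step _ _ hu) u rfl (hu.isGround hR ht)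
      exact ⟨n, .head hu hn⟩

/-- Both sides contain the same `X` and `Y`, so reducing these leads to the same literals on both
sides, and the reducts stay in `P`. The last argument `A` is never evaluated. -/
theorem BConv.of_lits (hR : IsLCSTRS R) (hqr : IsQuasiReductive R) (hint : IntTermsAreValues R)
    (hgt : IsBoundingOrder R gt) {σ τ : Sg.Typ} {U V : Term Sg (tInt ⇒ₜ tInt ⇒ₜ σ ⇒ₜ τ)}
    {X Y : Term Sg tInt} {A : Term Sg σ} (hU : U.IsGround) (hV : V.IsGround) (hX : X.IsGround)
    (hY : Y.IsGround) (hA : A.IsGround)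
    (h : ∀ m n : ℤ, BConv R gt (((U.app (lit m)).app (lit n)).app A)
      (((V.app (lit m)).app (lit n)).app A)) :
    BConv R gt (((U.app X).app Y).app A) (((V.app X).app Y).app A) := by
  intro P hP h₁ h₂
  obtain ⟨m, hm⟩ := exists_reduces_lit hR hqr hint hgt X hX
  obtain ⟨n, hn⟩ := exists_reduces_lit hR hqr hint hgt Y hY
  have red : ∀ W : Term Sg (tInt ⇒ₜ tInt ⇒ₜ σ ⇒ₜ τ), Relation.ReflTransGen (Step R)
      (((W.app X).app Y).app A) (((W.app (lit m)).app (lit n)).app A) := fun W =>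
    .trans (Relation.ReflTransGen.lift (fun X => ((W.app X).app Y).app A)
        (fun _ _ h => ((h.appR _).appL _).appL _) _ _ hm)
      (Relation.ReflTransGen.lift (fun Y => ((W.app (lit m)).app Y).app A)
        (fun _ _ h => (h.appR _).appL _) _ _ hn)
  obtain ⟨c₁, p₁⟩ := Conv.of_reduces hR hgt hP (red U) (by simp [*]) h₁
  obtain ⟨c₂, p₂⟩ := Conv.of_reduces hR hgt hP (red V) (by simp [*]) h₂
  exact (c₁.trans (h m n P hP p₁ p₂)).trans c₂.symm

theorem IsBoundingOrder.isDownClosed_ge_or_ge (hgt : IsBoundingOrder R gt)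
    (b c : Σ τ : Sg.Typ, Term Sg τ) : IsDownClosed gt fun w => gt.ge b w ∨ gt.ge c w := by
  have down : ∀ d u w, gt.ge d u → gt u w → gt.ge d w := by
    rintro d u w (rfl | h) huw
    · exact .inr huw
    · exact .inr (hgt.trans _ _ _ h huw)
  exact fun u w h huw => h.imp (down _ _ _ · huw) (down _ _ _ · huw)

/-- If one of the terms is reducible, a conversion can be taken to have at least one link. -/
theorem BConv.transGen (hR : IsLCSTRS R) (hgt : IsBoundingOrder R gt) {τ : Sg.Typ}
    {u w : Term Sg τ} (h : BConv R gt u w) (hu : u.IsGround) (hred : ∃ u', Step R u u') :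
    Relation.TransGen (BoundedLink R gt u w) u w := by
  obtain ⟨u', hu'⟩ := hred
  have hP := hgt.isDownClosed_ge_or_ge ⟨_, u⟩ ⟨_, w⟩
  have hl := Link.of_step hR hgt hP hu' hu (.inl (.inl rfl))
  exact .head' hl (.head hl.symm (h _ hP (.inl (.inl rfl)) (.inr (.inl rfl))))

end Conv

/-! ### Conversions between the recursors on literals -/

section Recursion

/-- Ground operators `F`, `G` that are convertible up to swapping the arguments, in a system with the
recursors. -/
structure IsSwapPair (R : RuleSet Sg) (r : Recursors Sg) (gt : TermRel Sg) (F G : Term Sg tOp) :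
    Prop where
  lcstrs : IsLCSTRS R
  recursors : IncludesRecursors R r
  order : IsBoundingOrder R gt
  left : F.IsGround
  right : G.IsGround
  swap : ∀ X Y : Term Sg tInt, X.IsGround → Y.IsGround → BConv R gt (F.app₂ X Y) (G.app₂ Y X)

variable {R : RuleSet Sg} {r : Recursors Sg} {gt : TermRel Sg} {F G : Term Sg tOp}
  {P : TermPred Sg}

theorem IsSwapPair.conv (S : IsSwapPair R r gt F G) (hP : IsDownClosed gt P) {τ : Sg.Typ}
    {s t : Term Sg τ} (hst : Steps R s t) (hs : s.IsGround) (h : P ⟨_, s⟩) : Conv R P s t :=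
  .of_steps S.lcstrs S.order hP hst hs h

theorem IsSwapPair.taildn_shift (S : IsSwapPair R r gt F G)
    (assoc : ∀ X Y Z : Term Sg tInt, X.IsGround → Y.IsGround → Z.IsGround →
      BConv R gt (F.app₂ X (G.app₂ Y Z)) (G.app₂ (F.app₂ X Y) Z))
    (req : ∀ (m n : ℤ) (A : Term Sg tInt), A.IsGround → m + 1 ≤ n →
      gt ⟨_, r.taildn G (lit (m + 1)) (lit n) (F.app₂ (lit m) A)⟩
        ⟨_, r.taildn G (lit (m + 1)) (lit (n - 1)) (F.app₂ (lit m) (G.app₂ A (lit n)))⟩)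
    {m n : ℤ} (hmn : m ≤ n) {B : Term Sg tInt} (hB : B.IsGround) :
    BConv R gt (r.taildn G (lit m) (lit n) B)
      (r.taildn G (lit (m + 1)) (lit n) (F.app₂ (lit m) B)) := by
  have hF := S.left
  have hG := S.right
  -- The induction is on `n - m`, with base `n = m`: on an empty range the two sides would reduce to
  -- `B` and `F m B`.
  obtain ⟨k, hk⟩ := Int.eq_ofNat_of_zero_le (sub_nonneg.2 hmn)
  induction k generalizing n B with
  | zero =>
    obtain rfl : n = m := by omega
    intro P hP h₁ h₂
    have s₁ := (taildn_unfold S.recursors G hmn rfl B).trans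
      (taildn_base S.recursors G (by omega) _)
    have s₂ := taildn_base S.recursors G (by omega : n < n + 1) (F.app₂ (lit n) B)
    exact ((S.conv hP s₁ (by simp [*]) h₁).trans
      (S.swap _ _ (by simp) hB P hP (hP.steps S.order s₂ h₂)
        (hP.steps S.order s₁ h₁)).symm).trans (S.conv hP s₂ (by simp [*]) h₂).symm
  | succ k ih =>
    intro P hP h₁ h₂
    have s₁ := taildn_unfold S.recursors G hmn rfl B
    have s₂ := taildn_unfold S.recursors G (by omega : m + 1 ≤ n) rfl (F.app₂ (lit m) B)
    have p₁ := hP.steps S.order s₁ h₁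
    have p₂ := hP.steps S.order s₂ h₂
    -- The junction `taildn G (m+1) (n-1) (F m (G B n))` is bounded through the right end.
    have p₃ := hP _ _ h₂ (req m n B hB (by omega))
    -- The law is applied to the accumulators only; they lie in `P` as subterms.
    have c := assoc (lit m) B (lit n) (by simp) hB (by simp) P hP (hP.arg S.order p₃)
      (hP.arg S.order p₂)
    exact (((S.conv hP s₁ (by simp [*]) h₁).trans
      (ih (by omega) (by simp [*]) (by omega) P hP p₁ p₃)).trans
      (c.appR (by simp [*]))).trans (S.conv hP s₂ (by simp [*]) h₂).symm

theorem IsSwapPair.tailup_taildn (S : IsSwapPair R r gt F G)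
    (assoc : ∀ X Y Z : Term Sg tInt, X.IsGround → Y.IsGround → Z.IsGround →
      BConv R gt (F.app₂ X (G.app₂ Y Z)) (G.app₂ (F.app₂ X Y) Z))
    (req₁ : ∀ (m n : ℤ) (A : Term Sg tInt), A.IsGround → m ≤ n →
      gt ⟨_, r.tailup F (lit m) (lit n) A⟩
        ⟨_, r.taildn G (lit (m + 1)) (lit n) (F.app₂ (lit m) A)⟩)
    (req₂ : ∀ (m n : ℤ) (A : Term Sg tInt), A.IsGround → m + 1 ≤ n →
      gt ⟨_, r.taildn G (lit (m + 1)) (lit n) (F.app₂ (lit m) A)⟩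
        ⟨_, r.taildn G (lit (m + 1)) (lit (n - 1)) (F.app₂ (lit m) (G.app₂ A (lit n)))⟩)
    (m n : ℤ) {A : Term Sg tInt} (hA : A.IsGround) :
    BConv R gt (r.tailup F (lit m) (lit n) A) (r.taildn G (lit m) (lit n) A) := by
  have hF := S.left
  have hG := S.right
  -- `k` bounds the number of iterations from above instead of equalling `n + 1 - m`, so that empty
  -- ranges with any `m > n` are covered.
  obtain ⟨k, hk⟩ : ∃ k : ℕ, n < m + k := ⟨(n + 1 - m).toNat, by omega⟩
  induction k generalizing m A with
  | zero =>
    intro P hP h₁ h₂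
    exact (S.conv hP (tailup_base S.recursors F (by omega) A) (by simp [*]) h₁).trans
      (S.conv hP (taildn_base S.recursors G (by omega) A) (by simp [*]) h₂).symm
  | succ k ih =>
    intro P hP h₁ h₂
    rcases lt_or_ge n m with hmn | hmn
    · exact (S.conv hP (tailup_base S.recursors F hmn A) (by simp [*]) h₁).trans
        (S.conv hP (taildn_base S.recursors G hmn A) (by simp [*]) h₂).symm
    · have s₁ := tailup_unfold S.recursors F hmn rfl A
      -- The junction `taildn G (m+1) n (F m A)`, common end of the induction hypothesis and of the
      -- shift.
      have p := hP _ _ h₁ (req₁ m n A hA hmn)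
      exact ((S.conv hP s₁ (by simp [*]) h₁).trans
        (ih (m + 1) (by simp [*]) (by push_cast at hk; omega) P hP
          (hP.steps S.order s₁ h₁) p)).trans
        (S.taildn_shift assoc req₂ hmn hA P hP h₂ p).symm

/-- The extra operand `k` is moved outwards past one operand `n` at a time by left commutativity,
and is turned around by the swap law once the range is empty. It stays fixed while `n` decreases, so
the requirement is needed for all `n ≥ m`, not just for `n = k - 1`. -/
theorem IsSwapPair.recdn_shift (S : IsSwapPair R r gt F G)
    (lcomm : ∀ X Y Z : Term Sg tInt, X.IsGround → Y.IsGround → Z.IsGround →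
      BConv R gt (F.app₂ X (F.app₂ Y Z)) (F.app₂ Y (F.app₂ X Z)))
    {m k : ℤ} {A : Term Sg tInt} (hA : A.IsGround)
    (req : ∀ n : ℤ, m ≤ n →
      gt ⟨_, r.recdn F (lit m) (lit n) (G.app₂ A (lit k))⟩
        ⟨_, F.app₂ (lit n) (F.app₂ (lit k) (r.recdn F (lit m) (lit (n - 1)) A))⟩)
    (n : ℤ) :
    BConv R gt (r.recdn F (lit m) (lit n) (G.app₂ A (lit k)))
      (F.app₂ (lit k) (r.recdn F (lit m) (lit n) A)) := by
  have hF := S.left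
  have hG := S.right
  have base : ∀ n < m, BConv R gt (r.recdn F (lit m) (lit n) (G.app₂ A (lit k)))
      (F.app₂ (lit k) (r.recdn F (lit m) (lit n) A)) := by
    intro n hn P hP h₁ h₂
    have s₁ := recdn_base S.recursors F hn (G.app₂ A (lit k))
    have s₂ := (recdn_base S.recursors F hn A).appR (F.app (lit k))
    exact ((S.conv hP s₁ (by simp [*]) h₁).trans
      (S.swap _ _ (by simp) hA P hP (hP.steps S.order s₂ h₂)
        (hP.steps S.order s₁ h₁)).symm).trans (S.conv hP s₂ (by simp [*]) h₂).symm
  obtain ⟨j, hj⟩ : ∃ j : ℕ, n < m + j := ⟨(n + 1 - m).toNat, by omega⟩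
  induction j generalizing n with
  | zero => exact base n (by omega)
  | succ j ih =>
    rcases lt_or_ge n m with hmn | hmn
    · exact base n hmn
    · intro P hP h₁ h₂
      have s₁ := recdn_unfold S.recursors F hmn rfl (G.app₂ A (lit k))
      have s₂ := (recdn_unfold S.recursors F hmn rfl A).appR (F.app (lit k))
      have p₁ := hP.steps S.order s₁ h₁
      have p₂ := hP.steps S.order s₂ h₂
      have p₃ := hP _ _ h₁ (req n hmn)
      have c := ih (n - 1) (by push_cast at hj; omega) P hP (hP.arg S.order p₁)
        (hP.arg S.order p₃)
      exact (((S.conv hP s₁ (by simp [*]) h₁).trans (c.appR (by simp [*]))).trans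
        (lcomm _ _ _ (by simp) (by simp) (by simp [*]) P hP p₃ p₂)).trans
        (S.conv hP s₂ (by simp [*]) h₂).symm

theorem IsSwapPair.taildn_recdn (S : IsSwapPair R r gt F G)
    (lcomm : ∀ X Y Z : Term Sg tInt, X.IsGround → Y.IsGround → Z.IsGround →
      BConv R gt (F.app₂ X (F.app₂ Y Z)) (F.app₂ Y (F.app₂ X Z)))
    (req₁ : ∀ (m n : ℤ) (A : Term Sg tInt), A.IsGround → m ≤ n →
      gt ⟨_, r.taildn G (lit m) (lit n) A⟩
        ⟨_, r.recdn F (lit m) (lit (n - 1)) (G.app₂ A (lit n))⟩)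
    (req₂ : ∀ (m n k : ℤ) (A : Term Sg tInt), A.IsGround → m ≤ k → m ≤ n →
      gt ⟨_, r.recdn F (lit m) (lit n) (G.app₂ A (lit k))⟩
        ⟨_, F.app₂ (lit n) (F.app₂ (lit k) (r.recdn F (lit m) (lit (n - 1)) A))⟩)
    (m n : ℤ) {A : Term Sg tInt} (hA : A.IsGround) :
    BConv R gt (r.taildn G (lit m) (lit n) A) (r.recdn F (lit m) (lit n) A) := by
  have hF := S.left
  have hG := S.right
  obtain ⟨k, hk⟩ : ∃ k : ℕ, n < m + k := ⟨(n + 1 - m).toNat, by omega⟩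
  induction k generalizing n A with
  | zero =>
    intro P hP h₁ h₂
    exact (S.conv hP (taildn_base S.recursors G (by omega) A) (by simp [*]) h₁).trans
      (S.conv hP (recdn_base S.recursors F (by omega) A) (by simp [*]) h₂).symm
  | succ k ih =>
    intro P hP h₁ h₂
    rcases lt_or_ge n m with hmn | hmn
    · exact (S.conv hP (taildn_base S.recursors G hmn A) (by simp [*]) h₁).trans
        (S.conv hP (recdn_base S.recursors F hmn A) (by simp [*]) h₂).symm
    · have s₁ := taildn_unfold S.recursors G hmn rfl A
      have s₂ := recdn_unfold S.recursors F hmn rfl A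
      have p := hP _ _ h₁ (req₁ m n A hA hmn)
      exact (((S.conv hP s₁ (by simp [*]) h₁).trans
        (ih (n - 1) (by simp [*]) (by push_cast at hk; omega) P hP
          (hP.steps S.order s₁ h₁) p)).trans
        (S.recdn_shift lcomm hA (fun j hj => req₂ m j n A hA hmn hj) (n - 1) P hP p
          (hP.steps S.order s₂ h₂))).trans
        (S.conv hP s₂ (by simp [*]) h₂).symm

/-- The mirror image of `recdn_shift`: `k` passes the operands `m` by right commutativity while the
lower end `m` increases. -/
theorem IsSwapPair.recup_shift (S : IsSwapPair R r gt F G)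
    (rcomm : ∀ X Y Z : Term Sg tInt, X.IsGround → Y.IsGround → Z.IsGround →
      BConv R gt (F.app₂ (F.app₂ X Y) Z) (F.app₂ (F.app₂ X Z) Y))
    {n k : ℤ} {A : Term Sg tInt} (hA : A.IsGround)
    (req : ∀ m : ℤ, m ≤ n →
      gt ⟨_, r.recup F (lit m) (lit n) (G.app₂ (lit k) A)⟩
        ⟨_, F.app₂ (F.app₂ (r.recup F (lit (m + 1)) (lit n) A) (lit k)) (lit m)⟩)
    (m : ℤ) :
    BConv R gt (r.recup F (lit m) (lit n) (G.app₂ (lit k) A))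
      (F.app₂ (r.recup F (lit m) (lit n) A) (lit k)) := by
  have hF := S.left
  have hG := S.right
  have base : ∀ m, n < m → BConv R gt (r.recup F (lit m) (lit n) (G.app₂ (lit k) A))
      (F.app₂ (r.recup F (lit m) (lit n) A) (lit k)) := by
    intro m hm P hP h₁ h₂
    have s₁ := recup_base S.recursors F hm (G.app₂ (lit k) A)
    have s₂ := ((recup_base S.recursors F hm A).appR F).appL (lit k)
    exact ((S.conv hP s₁ (by simp [*]) h₁).trans
      (S.swap _ _ hA (by simp) P hP (hP.steps S.order s₂ h₂)
        (hP.steps S.order s₁ h₁)).symm).trans (S.conv hP s₂ (by simp [*]) h₂).symm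
  obtain ⟨j, hj⟩ : ∃ j : ℕ, n < m + j := ⟨(n + 1 - m).toNat, by omega⟩
  induction j generalizing m with
  | zero => exact base m (by omega)
  | succ j ih =>
    rcases lt_or_ge n m with hmn | hmn
    · exact base m hmn
    · intro P hP h₁ h₂
      have s₁ := recup_unfold S.recursors F hmn rfl (G.app₂ (lit k) A)
      have s₂ := ((recup_unfold S.recursors F hmn rfl A).appR F).appL (lit k)
      have p₁ := hP.steps S.order s₁ h₁
      have p₂ := hP.steps S.order s₂ h₂
      have p₃ := hP _ _ h₁ (req m hmn)
      -- The recursive call is the first operand, hence the argument of the head of the application.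
      have c := ih (m + 1) (by push_cast at hj; omega) P hP
        (hP.arg S.order (hP.head S.order p₁)) (hP.arg S.order (hP.head S.order p₃))
      exact (((S.conv hP s₁ (by simp [*]) h₁).trans ((c.appR hF).appL (by simp))).trans
        (rcomm _ _ _ (by simp [*]) (by simp) (by simp) P hP p₃ p₂)).trans
        (S.conv hP s₂ (by simp [*]) h₂).symm

theorem IsSwapPair.tailup_recup (S : IsSwapPair R r gt F G)
    (rcomm : ∀ X Y Z : Term Sg tInt, X.IsGround → Y.IsGround → Z.IsGround →
      BConv R gt (F.app₂ (F.app₂ X Y) Z) (F.app₂ (F.app₂ X Z) Y))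
    (req₁ : ∀ (m n : ℤ) (A : Term Sg tInt), A.IsGround → m ≤ n →
      gt ⟨_, r.tailup G (lit m) (lit n) A⟩
        ⟨_, r.recup F (lit (m + 1)) (lit n) (G.app₂ (lit m) A)⟩)
    (req₂ : ∀ (m n k : ℤ) (A : Term Sg tInt), A.IsGround → k ≤ n → m ≤ n →
      gt ⟨_, r.recup F (lit m) (lit n) (G.app₂ (lit k) A)⟩
        ⟨_, F.app₂ (F.app₂ (r.recup F (lit (m + 1)) (lit n) A) (lit k)) (lit m)⟩)
    (m n : ℤ) {A : Term Sg tInt} (hA : A.IsGround) :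
    BConv R gt (r.tailup G (lit m) (lit n) A) (r.recup F (lit m) (lit n) A) := by
  have hF := S.left
  have hG := S.right
  obtain ⟨k, hk⟩ : ∃ k : ℕ, n < m + k := ⟨(n + 1 - m).toNat, by omega⟩
  induction k generalizing m A with
  | zero =>
    intro P hP h₁ h₂
    exact (S.conv hP (tailup_base S.recursors G (by omega) A) (by simp [*]) h₁).trans
      (S.conv hP (recup_base S.recursors F (by omega) A) (by simp [*]) h₂).symm
  | succ k ih =>
    intro P hP h₁ h₂
    rcases lt_or_ge n m with hmn | hmn
    · exact (S.conv hP (tailup_base S.recursors G hmn A) (by simp [*]) h₁).trans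
        (S.conv hP (recup_base S.recursors F hmn A) (by simp [*]) h₂).symm
    · have s₁ := tailup_unfold S.recursors G hmn rfl A
      have s₂ := recup_unfold S.recursors F hmn rfl A
      have p := hP _ _ h₁ (req₁ m n A hA hmn)
      exact (((S.conv hP s₁ (by simp [*]) h₁).trans
        (ih (m + 1) (by simp [*]) (by push_cast at hk; omega) P hP
          (hP.steps S.order s₁ h₁) p)).trans
        (S.recup_shift rcomm hA (fun j hj => req₂ j n m A hA hmn hj) (m + 1) P hP p
          (hP.steps S.order s₂ h₂))).trans
        (S.conv hP s₂ (by simp [*]) h₂).symm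

/-- The operand `m` on the outside right is pushed by associativity beneath the outermost operand
`n`, down to the innermost position, where the swap law turns `F A m` into `G m A`. -/
theorem IsSwapPair.recdn_extend (S : IsSwapPair R r gt F G)
    (assoc : ∀ X Y Z : Term Sg tInt, X.IsGround → Y.IsGround → Z.IsGround →
      BConv R gt (F.app₂ (G.app₂ X Y) Z) (G.app₂ X (F.app₂ Y Z)))
    (req : ∀ (m n : ℤ) (A : Term Sg tInt), A.IsGround → m + 1 ≤ n →
      gt ⟨_, G.app₂ (lit n) (r.recdn G (lit m) (lit (n - 1)) A)⟩
        ⟨_, G.app₂ (lit n) (F.app₂ (r.recdn G (lit (m + 1)) (lit (n - 1)) A) (lit m))⟩)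
    {m n : ℤ} (hmn : m ≤ n) {A : Term Sg tInt} (hA : A.IsGround) :
    BConv R gt (F.app₂ (r.recdn G (lit (m + 1)) (lit n) A) (lit m))
      (r.recdn G (lit m) (lit n) A) := by
  have hF := S.left
  have hG := S.right
  obtain ⟨k, hk⟩ := Int.eq_ofNat_of_zero_le (sub_nonneg.2 hmn)
  induction k generalizing n with
  | zero =>
    obtain rfl : n = m := by omega
    intro P hP h₁ h₂
    have s₁ := ((recdn_base S.recursors G (by omega : n < n + 1) A).appR F).appL (lit n)
    have s₂ := (recdn_unfold S.recursors G hmn rfl A).trans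
      ((recdn_base S.recursors G (by omega) A).appR _)
    exact ((S.conv hP s₁ (by simp [*]) h₁).trans
      (S.swap _ _ hA (by simp) P hP (hP.steps S.order s₁ h₁)
        (hP.steps S.order s₂ h₂))).trans (S.conv hP s₂ (by simp [*]) h₂).symm
  | succ k ih =>
    intro P hP h₁ h₂
    have s₁ := ((recdn_unfold S.recursors G (by omega : m + 1 ≤ n) rfl A).appR F).appL (lit m)
    have s₂ := recdn_unfold S.recursors G hmn rfl A
    have p₁ := hP.steps S.order s₁ h₁
    have p₂ := hP.steps S.order s₂ h₂
    -- The requirement starts from the unfolded right side, not from the right end itself.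
    have p₃ := hP _ _ p₂ (req m n A hA (by omega))
    have c := ih (n := n - 1) (by omega) (by omega) P hP (hP.arg S.order p₃)
      (hP.arg S.order p₂)
    exact (((S.conv hP s₁ (by simp [*]) h₁).trans
      (assoc _ _ _ (by simp) (by simp [*]) (by simp) P hP p₁ p₃)).trans
      (c.appR (by simp [*]))).trans (S.conv hP s₂ (by simp [*]) h₂).symm

theorem IsSwapPair.recup_recdn (S : IsSwapPair R r gt F G)
    (assoc : ∀ X Y Z : Term Sg tInt, X.IsGround → Y.IsGround → Z.IsGround →
      BConv R gt (F.app₂ (G.app₂ X Y) Z) (G.app₂ X (F.app₂ Y Z)))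
    (req₁ : ∀ (m n : ℤ) (A : Term Sg tInt), A.IsGround → m ≤ n →
      gt ⟨_, r.recup F (lit m) (lit n) A⟩
        ⟨_, F.app₂ (r.recdn G (lit (m + 1)) (lit n) A) (lit m)⟩)
    (req₂ : ∀ (m n : ℤ) (A : Term Sg tInt), A.IsGround → m + 1 ≤ n →
      gt ⟨_, G.app₂ (lit n) (r.recdn G (lit m) (lit (n - 1)) A)⟩
        ⟨_, G.app₂ (lit n) (F.app₂ (r.recdn G (lit (m + 1)) (lit (n - 1)) A) (lit m))⟩)
    (m n : ℤ) {A : Term Sg tInt} (hA : A.IsGround) :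
    BConv R gt (r.recup F (lit m) (lit n) A) (r.recdn G (lit m) (lit n) A) := by
  have hF := S.left
  have hG := S.right
  obtain ⟨k, hk⟩ : ∃ k : ℕ, n < m + k := ⟨(n + 1 - m).toNat, by omega⟩
  induction k generalizing m with
  | zero =>
    intro P hP h₁ h₂
    exact (S.conv hP (recup_base S.recursors F (by omega) A) (by simp [*]) h₁).trans
      (S.conv hP (recdn_base S.recursors G (by omega) A) (by simp [*]) h₂).symm
  | succ k ih =>
    intro P hP h₁ h₂
    rcases lt_or_ge n m with hmn | hmn
    · exact (S.conv hP (recup_base S.recursors F hmn A) (by simp [*]) h₁).trans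
        (S.conv hP (recdn_base S.recursors G hmn A) (by simp [*]) h₂).symm
    · have s₁ := recup_unfold S.recursors F hmn rfl A
      have p := hP _ _ h₁ (req₁ m n A hA hmn)
      have c := ih (m + 1) (by push_cast at hk; omega) P hP
        (hP.arg S.order (hP.head S.order (hP.steps S.order s₁ h₁)))
        (hP.arg S.order (hP.head S.order p))
      exact ((S.conv hP s₁ (by simp [*]) h₁).trans ((c.appR hF).appL (by simp))).trans
        (S.recdn_extend assoc req₂ hmn hA P hP p h₂)

end Recursion

/-! ### Instances of context equations and requirements -/

section Instances

variable {H : Sg.Typ → Type} {R : RuleSet Sg} {gt : TermRel Sg} {s : ∀ τ, H τ → Term Sg τ}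
  {γ : Subst Sg}

/-- Replacing the boxes and the variables by terms. -/
def Tm.inst (S : ∀ τ, H τ → Term Sg τ) (g : Subst Sg) : {τ : Sg.Typ} → Tm Sg H τ → Term Sg τ
  | _, .var x => g _ x
  | _, .th f => .th f
  | _, .fn f => .fn f
  | _, .box h => S _ h
  | _, .app u w => .app (u.inst S g) (w.inst S g)

theorem Tm.vars_fill_subset {τ : Sg.Typ} (t : Tm Sg H τ) {V : Set (Σ τ : Sg.Typ, Sg.Var τ)}
    (ht : t.vars ⊆ V) (hs : ∀ τ h, (s τ h).vars ⊆ V) : (t.fill s).vars ⊆ V := by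
  induction t with
  | var x => exact ht
  | th f => exact ht
  | fn f => exact ht
  | box h => exact hs _ h
  | app u w ihu ihw =>
    exact Set.union_subset (ihu (Set.union_subset_iff.1 ht).1) (ihw (Set.union_subset_iff.1 ht).2)

open Classical in
/-- The substitution that is `g` on `V` and `γ` elsewhere. -/
noncomputable def Subst.override (γ g : Subst Sg) (V : Set (Σ τ : Sg.Typ, Sg.Var τ)) :
    Subst Sg :=
  fun τ x => if ⟨τ, x⟩ ∈ V then g τ x else γ τ x

theorem Subst.override_of_mem {g : Subst Sg} {V : Set (Σ τ : Sg.Typ, Sg.Var τ)}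
    {x : Σ τ : Sg.Typ, Sg.Var τ} (hx : x ∈ V) : γ.override g V x.1 x.2 = g x.1 x.2 :=
  if_pos hx

theorem Subst.override_of_notMem {g : Subst Sg} {V : Set (Σ τ : Sg.Typ, Sg.Var τ)}
    {x : Σ τ : Sg.Typ, Sg.Var τ} (hx : x ∉ V) : γ.override g V x.1 x.2 = γ x.1 x.2 :=
  if_neg hx

/-- Disjointness prevents capture: inside the boxes only `γ` acts, outside them only `g`. -/
theorem Tm.fill_subst_override {g : Subst Sg} {V : Set (Σ τ : Sg.Typ, Sg.Var τ)}
    (hs : ∀ τ h, Disjoint (s τ h).vars V) {τ : Sg.Typ} (t : Tm Sg H τ) (ht : t.vars ⊆ V) :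
    (t.fill s).subst (γ.override g V) = t.inst (fun τ h => (s τ h).subst γ) g := by
  induction t with
  | var x => exact Subst.override_of_mem (ht rfl)
  | th f => rfl
  | fn f => rfl
  | box h =>
    exact Tm.subst_congr _ fun x hx =>
      Subst.override_of_notMem (Set.disjoint_left.1 (hs _ h) hx)
  | app u w ihu ihw =>
    simp only [Tm.fill, Tm.subst, Tm.inst]
    rw [ihu (Set.union_subset_iff.1 ht).1, ihw (Set.union_subset_iff.1 ht).2]

theorem Subst.IsGround.override (hγ : γ.IsGround) {g : Subst Sg}
    {V : Set (Σ τ : Sg.Typ, Sg.Var τ)} (hg : ∀ x ∈ V, (g x.1 x.2).IsGround) :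
    (γ.override g V).IsGround := by
  intro x hx
  by_cases hV : x ∈ V
  · rw [override_of_mem hV]
    exact hg x hV
  · rw [Subst.dom, Set.mem_ofPred_eq, override_of_notMem hV] at hx
    rw [override_of_notMem hV]
    exact hγ x hx

/-- A variable with a ground image is moved, so all overridden variables belong to the domain. -/
theorem Subst.subset_dom_override {g : Subst Sg} {V W : Set (Σ τ : Sg.Typ, Sg.Var τ)}
    (hg : ∀ x ∈ V, (g x.1 x.2).IsGround) (hW : W ⊆ V ∪ γ.dom) :
    W ⊆ (γ.override g V).dom := by
  intro x hx
  rw [Subst.dom, Set.mem_ofPred_eq]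
  by_cases hV : x ∈ V
  · rw [override_of_mem hV]
    exact (hg x hV).ne_var _
  · rw [override_of_notMem hV]
    exact (hW hx).resolve_left hV

/-- The requirement is used at `γ` overridden by `g` on its own variables. This keeps the box
instances of `γ` and allows any ground values for the rest. -/
theorem CtxReq.Holds.inst {o : CtxReq Sg H} (ho : o.Holds gt s)
    (hs : ∀ τ h, Disjoint (s τ h).vars o.vars) (hγ : γ.IsGround)
    (hdom : ∀ τ h, (s τ h).vars ⊆ γ.dom) (g : Subst Sg)
    (hg : ∀ x ∈ o.vars, (g x.1 x.2).IsGround)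
    (hc : (o.constraint.fill s).vars ⊆ o.constraint.vars)
    (hv : ∀ x ∈ o.constraint.vars, IsValue (g x.1 x.2))
    (he : (o.constraint.inst (fun τ h => (s τ h).subst γ) g).eval = some true) :
    gt ⟨_, o.lhs.inst (fun τ h => (s τ h).subst γ) g⟩
      ⟨_, o.rhs.inst (fun τ h => (s τ h).subst γ) g⟩ := by
  have hl : o.lhs.vars ⊆ o.vars := fun x hx => .inl (.inl hx)
  have hr : o.rhs.vars ⊆ o.vars := fun x hx => .inl (.inr hx)
  have hφ : o.constraint.vars ⊆ o.vars := fun x hx => .inr hx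
  have hfill : ∀ {τ} (t : Tm Sg H τ), t.vars ⊆ o.vars → (t.fill s).vars ⊆ o.vars ∪ γ.dom :=
    fun t ht => t.vars_fill_subset (ht.trans Set.subset_union_left)
      fun τ h => (hdom τ h).trans Set.subset_union_right
  have key := ho (γ.override g o.vars) (hγ.override hg)
    ⟨fun x hx => by
      rw [Subst.override_of_mem (hφ (hc hx))]
      exact hv x (hc hx), by rwa [Tm.fill_subst_override hs _ hφ]⟩
    (Subst.subset_dom_override hg (Set.union_subset (hfill _ hl) (hfill _ hr)))
  rwa [Tm.fill_subst_override hs _ hl, Tm.fill_subst_override hs _ hr] at key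

theorem CtxEqn.Holds.inst {e : CtxEqn Sg H} (ho : e.Holds R gt s)
    (hs : ∀ τ h, Disjoint (s τ h).vars e.vars) (hγ : γ.IsGround)
    (hdom : ∀ τ h, (s τ h).vars ⊆ γ.dom) (g : Subst Sg)
    (hg : ∀ x ∈ e.vars, (g x.1 x.2).IsGround) (hc : e.constraint = tt) :
    BConv R gt (e.lhs.inst (fun τ h => (s τ h).subst γ) g)
      (e.rhs.inst (fun τ h => (s τ h).subst γ) g) := by
  have hl : e.lhs.vars ⊆ e.vars := fun x hx => .inl (.inl hx)
  have hr : e.rhs.vars ⊆ e.vars := fun x hx => .inl (.inr hx)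
  have hfill : ∀ {τ} (t : Tm Sg H τ), t.vars ⊆ e.vars → (t.fill s).vars ⊆ e.vars ∪ γ.dom :=
    fun t ht => t.vars_fill_subset (ht.trans Set.subset_union_left)
      fun τ h => (hdom τ h).trans Set.subset_union_right
  intro P hP h₁ h₂
  rw [← Tm.fill_subst_override hs _ hl] at h₁ ⊢
  rw [← Tm.fill_subst_override hs _ hr] at h₂ ⊢
  rcases ho.2 with h | h
  · rw [h]
    exact .refl
  · have key := h (γ.override g e.vars) (hγ.override hg)
      (by rw [hc]; exact ⟨fun x hx => hx.elim, rfl⟩)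
      (Subst.subset_dom_override hg (Set.union_subset (hfill _ hl) (hfill _ hr)))
    -- A bound by one of the two ends becomes membership in `P`, as `P` contains both ends and is
    -- closed downwards.
    have mono : ∀ d w : Σ τ : Sg.Typ, Term Sg τ, P d → gt.ge d w → P w := by
      rintro d w hd (rfl | h)
      · exact hd
      · exact hP _ _ hd h
    refine Relation.ReflTransGen.mono ?_ _ _ key.to_reflTransGen
    rintro u w ⟨σ, C, l, r, hC, hl, hr, hu, hw, hst, hbl, hbr⟩
    exact ⟨σ, C, l, r, hC, hl, hr, hu, hw, hst, hbl.elim (mono _ _ h₁) (mono _ _ h₂),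
      hbr.elim (mono _ _ h₁) (mono _ _ h₂)⟩

end Instances

/-! ### Reduction of the claims to recursor calls on literals -/

section TwoOperators

variable {R : RuleSet Sg} {gt : TermRel Sg} {s : ∀ τ, TwoOps τ → Term Sg τ}

/-- Both box terms must be ground under `γ`, whose domain is only known to cover the variables of
the equation; `hpq` says that the boxes of the equation account for all box variables. A recursor
call is not a value, hence reducible, which gives `BConv.transGen` its first link. -/
theorem CtxEqn.holds_recursors (hR : IsLCSTRS R) (hqr : IsQuasiReductive R)
    (hint : IntTermsAreValues R) (hgt : IsBoundingOrder R gt) (f g : Sg.Fn tRec)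
    (p q : TwoOps (tOp : Sg.Typ))
    (hpq : ∀ (τ : Sg.Typ) (h : TwoOps τ), (s τ h).vars ⊆ (s _ p).vars ∪ (s _ q).vars)
    (x y a : Sg.Var tInt)
    (h : ∀ γ : Subst Sg, γ.IsGround → (∀ τ h, (s τ h).vars ⊆ γ.dom) →
      ∀ (m n : ℤ) (A : Term Sg tInt), A.IsGround →
        BConv R gt (((((Tm.fn f).app ((s _ p).subst γ)).app (lit m)).app (lit n)).app A)
          (((((Tm.fn g).app ((s _ q).subst γ)).app (lit m)).app (lit n)).app A)) :
    CtxEqn.Holds R gt s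
      ⟨((((Tm.fn f).app (.box p)).app (v x)).app (v y)).app (v a),
        ((((Tm.fn g).app (.box q)).app (v x)).app (v y)).app (v a), tt⟩ := by
  refine ⟨⟨trivial, fun x hx => hx.elim⟩, .inr fun γ hγ _ hdom => ?_⟩
  have hgr := hγ.isGround_subst (Set.subset_union_left.trans hdom)
  have hgr' := hγ.isGround_subst (Set.subset_union_right.trans hdom)
  simp only [Tm.fill, Tm.subst, Tm.isGround_app] at hgr hgr'
  have hsdom : ∀ (τ : Sg.Typ) (h : TwoOps τ), (s τ h).vars ⊆ γ.dom := fun τ h =>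
    (hpq τ h).trans (.trans (Set.union_subset_union
      (by intro z hz; simp [Tm.fill, Tm.vars, hz])
      (by intro z hz; simp [Tm.fill, Tm.vars, hz])) hdom)
  have key : BConv R gt
      (((((Tm.fn f).app ((s _ p).subst γ)).app (γ _ x)).app (γ _ y)).app (γ _ a))
      (((((Tm.fn g).app ((s _ q).subst γ)).app (γ _ x)).app (γ _ y)).app (γ _ a)) :=
    .of_lits hR hqr hint hgt (by simp [hgr]) (by simp [hgr']) hgr.1.1.2 hgr.1.2 hgr.2
      fun m n => h γ hγ hsdom m n _ hgr.2
  exact key.transGen hR hgt (by simp [hgr])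
    (exists_step_of_not_isValue hqr hint (by simp [hgr]) nofun)

theorem exists_assignment {x y z a x₁ x₂ y₁ y₂ : Sg.Var tInt}
    (hvars : [x, y, z, a, x₁, x₂, y₁, y₂].Nodup) (X Y Z A X₁ X₂ Y₁ Y₂ : Term Sg tInt) :
    ∃ g : Sg.Var tInt → Term Sg tInt, g x = X ∧ g y = Y ∧ g z = Z ∧ g a = A ∧ g x₁ = X₁ ∧
      g x₂ = X₂ ∧ g y₁ = Y₁ ∧ g y₂ = Y₂ := by
  classical
  refine ⟨fun w => if w = x then X else if w = y then Y else if w = z then Z else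
    if w = a then A else if w = x₁ then X₁ else if w = x₂ then X₂ else if w = y₁ then Y₁ else
    Y₂, ?_⟩
  simp only [List.nodup_cons, List.mem_cons, List.not_mem_nil, or_false, not_or] at hvars
  grind

end TwoOperators

/-! ### The four conditional bounded inductive theorems -/

section Main

variable {R : RuleSet Sg} {r : Recursors Sg} {gt : TermRel Sg}
  {x y z a x₁ x₂ y₁ y₂ : Sg.Var tInt}

theorem IsSwapPair.of_holds {s : ∀ τ, TwoOps τ → Term Sg τ} {γ : Subst Sg} (hR : IsLCSTRS R)
    (hrec : IncludesRecursors R r) (hgt : IsBoundingOrder R gt)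
    (hvars : [x, y, z, a, x₁, x₂, y₁, y₂].Nodup) (hγ : γ.IsGround)
    (hdom : ∀ τ h, (s τ h).vars ⊆ γ.dom)
    (h : CtxEqn.Holds R gt s ⟨box₁ (v x) (v y), box₂ (v y) (v x), tt⟩)
    (hs : ∀ τ h, Disjoint (s τ h).vars
      (CtxEqn.vars ⟨box₁ (v x) (v y), box₂ (v y) (v x), tt⟩)) :
    IsSwapPair R r gt ((s _ .one).subst γ) ((s _ .two).subst γ) := by
  refine ⟨hR, hrec, hgt, hγ.isGround_subst (hdom _ _), hγ.isGround_subst (hdom _ _),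
    fun X Y hX hY => ?_⟩
  obtain ⟨g, hx, hy, -⟩ := exists_assignment hvars X Y X X X X X X
  simpa [Tm.inst, hx, hy] using h.inst hs hγ hdom (intSubst g)
    (by simp [CtxEqn.vars, Tm.vars, *]) rfl

theorem tailup_taildn_isCondBoundedInductiveTheorem (hR : IsLCSTRS R)
    (hqr : IsQuasiReductive R) (hint : IntTermsAreValues R) (hrec : IncludesRecursors R r)
    (hgt : IsBoundingOrder R gt) (hvars : [x, y, z, a, x₁, x₂, y₁, y₂].Nodup) :
    IsCondBoundedInductiveTheorem R gt
      { ⟨box₁ (v x) (box₂ (v y) (v z)), box₂ (box₁ (v x) (v y)) (v z), tt⟩,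
        ⟨box₁ (v x) (v y), box₂ (v y) (v x), tt⟩ }
      { ⟨r.tailup □₁ (v x) (v y) (v a), r.taildn □₂ (v x) (v y) (v a), tt⟩ }
      { ⟨r.tailup □₁ (v x) (v y) (v a),
          r.taildn □₂ (v x₁) (v y) (box₁ (v x) (v a)),
          v x ≤ₜ v y ∧ₜ v x₁ =ₜ v x +ₜ lit 1 ∧ₜ v y₁ =ₜ v y -ₜ lit 1⟩,
        ⟨r.taildn □₂ (v x₁) (v y) (box₁ (v x) (v a)),
          r.taildn □₂ (v x₁) (v y₁) (box₁ (v x) (box₂ (v a) (v y))),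
          v x ≤ₜ v y ∧ₜ v x₁ =ₜ v x +ₜ lit 1 ∧ₜ v y₁ =ₜ v y -ₜ lit 1 ∧ₜ v x₁ ≤ₜ v y⟩ } := by
  intro s hs hA hO
  simp only [Set.mem_insert_iff, Set.mem_singleton_iff, forall_eq_or_imp, forall_eq] at hA hO ⊢
  obtain ⟨hA₁, hA₂⟩ := hA
  obtain ⟨hO₁, hO₂⟩ := hO
  refine CtxEqn.holds_recursors hR hqr hint hgt _ _ .one .two (by rintro _ (_ | _) <;> simp) x y a
    fun γ hγ hdom => ?_
  have S := IsSwapPair.of_holds hR hrec hgt hvars hγ hdom hA₂ fun τ h => (hs τ h).1 _ (by simp)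
  refine S.tailup_taildn (fun X Y Z hX hY hZ => ?_) (fun m n A hA hmn => ?_)
    (fun m n A hA hmn => ?_)
  · obtain ⟨g, hx, hy, hz, -⟩ := exists_assignment hvars X Y Z X X X X X
    simpa [Tm.inst, hx, hy, hz] using hA₁.inst (fun τ h => (hs τ h).1 _ (by simp)) hγ hdom
      (intSubst g) (by simp [CtxEqn.vars, Tm.vars, *]) rfl
  -- No term of this requirement contains `y₁`, but its constraint does, so `y₁` still needs the
  -- value `n - 1`.
  · obtain ⟨g, hx, hy, -, ha, hx₁, -, hy₁, -⟩ := exists_assignment hvars (lit m) (lit n) A A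
      (lit (m + 1)) A (lit (n - 1)) A
    simpa [Tm.inst, hx, hy, ha, hx₁, hy₁] using hO₁.inst
      (fun τ h => (hs τ h).2 _ (by simp)) hγ hdom (intSubst g)
      (by simp [CtxReq.vars, Tm.vars, *]) subset_rfl (by simp [Tm.vars, isValue_lit, *])
      (by simp [Tm.inst, Tm.eval, ThSym.sem, *]; rfl)
  -- The constraint contains both `x ≤ y` and `x₁ ≤ y`; the latter evaluates to `m + 1 ≤ n`, that is
  -- `m < n`.
  · have hle : m ≤ n := by omega
    have hlt : m < n := by omega
    obtain ⟨g, hx, hy, -, ha, hx₁, -, hy₁, -⟩ := exists_assignment hvars (lit m) (lit n) A A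
      (lit (m + 1)) A (lit (n - 1)) A
    simpa [Tm.inst, hx, hy, ha, hx₁, hy₁] using hO₂.inst
      (fun τ h => (hs τ h).2 _ (by simp)) hγ hdom (intSubst g)
      (by simp [CtxReq.vars, Tm.vars, *]) subset_rfl (by simp [Tm.vars, isValue_lit, *])
      (by simp [Tm.inst, Tm.eval, ThSym.sem, *]; rfl)

theorem taildn_recdn_isCondBoundedInductiveTheorem (hR : IsLCSTRS R)
    (hqr : IsQuasiReductive R) (hint : IntTermsAreValues R) (hrec : IncludesRecursors R r)
    (hgt : IsBoundingOrder R gt) (hvars : [x, y, z, a, x₁, x₂, y₁, y₂].Nodup) :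
    IsCondBoundedInductiveTheorem R gt
      { ⟨box₁ (v x) (box₁ (v y) (v z)), box₁ (v y) (box₁ (v x) (v z)), tt⟩,
        ⟨box₁ (v x) (v y), box₂ (v y) (v x), tt⟩ }
      { ⟨r.taildn □₂ (v x) (v y) (v a), r.recdn □₁ (v x) (v y) (v a), tt⟩ }
      { ⟨r.taildn □₂ (v x) (v y) (v a),
          r.recdn □₁ (v x) (v y₁) (box₂ (v a) (v y)),
          v x ≤ₜ v y ∧ₜ v y₁ =ₜ v y -ₜ lit 1⟩,
        ⟨r.recdn □₁ (v x) (v y₁) (box₂ (v a) (v y)),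
          box₁ (v y₁) (box₁ (v y) (r.recdn □₁ (v x) (v y₂) (v a))),
          v x ≤ₜ v y ∧ₜ v x ≤ₜ v y₁ ∧ₜ v y₂ =ₜ v y₁ -ₜ lit 1⟩ } := by
  intro s hs hA hO
  simp only [Set.mem_insert_iff, Set.mem_singleton_iff, forall_eq_or_imp, forall_eq] at hA hO ⊢
  obtain ⟨hA₁, hA₂⟩ := hA
  obtain ⟨hO₁, hO₂⟩ := hO
  refine CtxEqn.holds_recursors hR hqr hint hgt _ _ .two .one (by rintro _ (_ | _) <;> simp) x y a
    fun γ hγ hdom => ?_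
  have S := IsSwapPair.of_holds hR hrec hgt hvars hγ hdom hA₂ fun τ h => (hs τ h).1 _ (by simp)
  refine S.taildn_recdn (fun X Y Z hX hY hZ => ?_) (fun m n A hA hmn => ?_)
    (fun m n k A hA hmk hmn => ?_)
  · obtain ⟨g, hx, hy, hz, -⟩ := exists_assignment hvars X Y Z X X X X X
    simpa [Tm.inst, hx, hy, hz] using hA₁.inst (fun τ h => (hs τ h).1 _ (by simp)) hγ hdom
      (intSubst g) (by simp [CtxEqn.vars, Tm.vars, *]) rfl
  · obtain ⟨g, hx, hy, -, ha, -, -, hy₁, -⟩ := exists_assignment hvars (lit m) (lit n) A A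
      A A (lit (n - 1)) A
    simpa [Tm.inst, hx, hy, ha, hy₁] using hO₁.inst
      (fun τ h => (hs τ h).2 _ (by simp)) hγ hdom (intSubst g)
      (by simp [CtxReq.vars, Tm.vars, *]) subset_rfl (by simp [Tm.vars, isValue_lit, *])
      (by simp [Tm.inst, Tm.eval, ThSym.sem, *]; rfl)
  -- Here `y` is the operand `k` being moved and `y₁` the current upper end `n`; the constraint does
  -- not tie them together.
  · obtain ⟨g, hx, hy, -, ha, -, -, hy₁, hy₂⟩ := exists_assignment hvars (lit m) (lit k) A A
      A A (lit n) (lit (n - 1))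
    simpa [Tm.inst, hx, hy, ha, hy₁, hy₂] using hO₂.inst
      (fun τ h => (hs τ h).2 _ (by simp)) hγ hdom (intSubst g)
      (by simp [CtxReq.vars, Tm.vars, *]) subset_rfl (by simp [Tm.vars, isValue_lit, *])
      (by simp [Tm.inst, Tm.eval, ThSym.sem, *]; rfl)

theorem tailup_recup_isCondBoundedInductiveTheorem (hR : IsLCSTRS R)
    (hqr : IsQuasiReductive R) (hint : IntTermsAreValues R) (hrec : IncludesRecursors R r)
    (hgt : IsBoundingOrder R gt) (hvars : [x, y, z, a, x₁, x₂, y₁, y₂].Nodup) :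
    IsCondBoundedInductiveTheorem R gt
      { ⟨box₁ (box₁ (v x) (v y)) (v z), box₁ (box₁ (v x) (v z)) (v y), tt⟩,
        ⟨box₁ (v x) (v y), box₂ (v y) (v x), tt⟩ }
      { ⟨r.tailup □₂ (v x) (v y) (v a), r.recup □₁ (v x) (v y) (v a), tt⟩ }
      { ⟨r.tailup □₂ (v x) (v y) (v a),
          r.recup □₁ (v x₁) (v y) (box₂ (v x) (v a)),
          v x ≤ₜ v y ∧ₜ v x₁ =ₜ v x +ₜ lit 1⟩,
        ⟨r.recup □₁ (v x₁) (v y) (box₂ (v x) (v a)),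
          box₁ (box₁ (r.recup □₁ (v x₂) (v y) (v a)) (v x)) (v x₁),
          v x ≤ₜ v y ∧ₜ v x₁ ≤ₜ v y ∧ₜ v x₂ =ₜ v x₁ +ₜ lit 1⟩ } := by
  intro s hs hA hO
  simp only [Set.mem_insert_iff, Set.mem_singleton_iff, forall_eq_or_imp, forall_eq] at hA hO ⊢
  obtain ⟨hA₁, hA₂⟩ := hA
  obtain ⟨hO₁, hO₂⟩ := hO
  refine CtxEqn.holds_recursors hR hqr hint hgt _ _ .two .one (by rintro _ (_ | _) <;> simp) x y a
    fun γ hγ hdom => ?_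
  have S := IsSwapPair.of_holds hR hrec hgt hvars hγ hdom hA₂ fun τ h => (hs τ h).1 _ (by simp)
  refine S.tailup_recup (fun X Y Z hX hY hZ => ?_) (fun m n A hA hmn => ?_)
    (fun m n k A hA hkn hmn => ?_)
  · obtain ⟨g, hx, hy, hz, -⟩ := exists_assignment hvars X Y Z X X X X X
    simpa [Tm.inst, hx, hy, hz] using hA₁.inst (fun τ h => (hs τ h).1 _ (by simp)) hγ hdom
      (intSubst g) (by simp [CtxEqn.vars, Tm.vars, *]) rfl
  · obtain ⟨g, hx, hy, -, ha, hx₁, -⟩ := exists_assignment hvars (lit m) (lit n) A A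
      (lit (m + 1)) A A A
    simpa [Tm.inst, hx, hy, ha, hx₁] using hO₁.inst
      (fun τ h => (hs τ h).2 _ (by simp)) hγ hdom (intSubst g)
      (by simp [CtxReq.vars, Tm.vars, *]) subset_rfl (by simp [Tm.vars, isValue_lit, *])
      (by simp [Tm.inst, Tm.eval, ThSym.sem, *]; rfl)
  -- Here `x` is the operand `k` being moved and `x₁` the current lower end `m`, again independent
  -- of each other.
  · obtain ⟨g, hx, hy, -, ha, hx₁, hx₂, -⟩ := exists_assignment hvars (lit k) (lit n) A A
      (lit m) (lit (m + 1)) A A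
    simpa [Tm.inst, hx, hy, ha, hx₁, hx₂] using hO₂.inst
      (fun τ h => (hs τ h).2 _ (by simp)) hγ hdom (intSubst g)
      (by simp [CtxReq.vars, Tm.vars, *]) subset_rfl (by simp [Tm.vars, isValue_lit, *])
      (by simp [Tm.inst, Tm.eval, ThSym.sem, *]; rfl)

theorem recup_recdn_isCondBoundedInductiveTheorem (hR : IsLCSTRS R)
    (hqr : IsQuasiReductive R) (hint : IntTermsAreValues R) (hrec : IncludesRecursors R r)
    (hgt : IsBoundingOrder R gt) (hvars : [x, y, z, a, x₁, x₂, y₁, y₂].Nodup) :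
    IsCondBoundedInductiveTheorem R gt
      { ⟨box₁ (box₂ (v x) (v y)) (v z), box₂ (v x) (box₁ (v y) (v z)), tt⟩,
        ⟨box₁ (v x) (v y), box₂ (v y) (v x), tt⟩ }
      { ⟨r.recup □₁ (v x) (v y) (v a), r.recdn □₂ (v x) (v y) (v a), tt⟩ }
      { ⟨r.recup □₁ (v x) (v y) (v a),
          box₁ (r.recdn □₂ (v x₁) (v y) (v a)) (v x),
          v x ≤ₜ v y ∧ₜ v x₁ =ₜ v x +ₜ lit 1⟩,
        ⟨box₂ (v y) (r.recdn □₂ (v x) (v y₁) (v a)),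
          box₂ (v y) (box₁ (r.recdn □₂ (v x₁) (v y₁) (v a)) (v x)),
          v x ≤ₜ v y ∧ₜ v x₁ =ₜ v x +ₜ lit 1 ∧ₜ v y₁ =ₜ v y -ₜ lit 1 ∧ₜ v x₁ ≤ₜ v y⟩ } := by
  intro s hs hA hO
  simp only [Set.mem_insert_iff, Set.mem_singleton_iff, forall_eq_or_imp, forall_eq] at hA hO ⊢
  obtain ⟨hA₁, hA₂⟩ := hA
  obtain ⟨hO₁, hO₂⟩ := hO
  refine CtxEqn.holds_recursors hR hqr hint hgt _ _ .one .two (by rintro _ (_ | _) <;> simp) x y a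
    fun γ hγ hdom => ?_
  have S := IsSwapPair.of_holds hR hrec hgt hvars hγ hdom hA₂ fun τ h => (hs τ h).1 _ (by simp)
  refine S.recup_recdn (fun X Y Z hX hY hZ => ?_) (fun m n A hA hmn => ?_)
    (fun m n A hA hmn => ?_)
  · obtain ⟨g, hx, hy, hz, -⟩ := exists_assignment hvars X Y Z X X X X X
    simpa [Tm.inst, hx, hy, hz] using hA₁.inst (fun τ h => (hs τ h).1 _ (by simp)) hγ hdom
      (intSubst g) (by simp [CtxEqn.vars, Tm.vars, *]) rfl
  · obtain ⟨g, hx, hy, -, ha, hx₁, -⟩ := exists_assignment hvars (lit m) (lit n) A A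
      (lit (m + 1)) A A A
    simpa [Tm.inst, hx, hy, ha, hx₁] using hO₁.inst
      (fun τ h => (hs τ h).2 _ (by simp)) hγ hdom (intSubst g)
      (by simp [CtxReq.vars, Tm.vars, *]) subset_rfl (by simp [Tm.vars, isValue_lit, *])
      (by simp [Tm.inst, Tm.eval, ThSym.sem, *]; rfl)
  · have hle : m ≤ n := by omega
    have hlt : m < n := by omega
    obtain ⟨g, hx, hy, -, ha, hx₁, -, hy₁, -⟩ := exists_assignment hvars (lit m) (lit n) A A
      (lit (m + 1)) A (lit (n - 1)) A
    simpa [Tm.inst, hx, hy, ha, hx₁, hy₁] using hO₂.inst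
      (fun τ h => (hs τ h).2 _ (by simp)) hγ hdom (intSubst g)
      (by simp [CtxReq.vars, Tm.vars, *]) subset_rfl (by simp [Tm.vars, isValue_lit, *])
      (by simp [Tm.inst, Tm.eval, ThSym.sem, *]; rfl)

end Main

end LCSTRS

theorem mainTheorem1 (Sg : Signature) (R : RuleSet Sg) (hR : IsLCSTRS R)
    (hqr : IsQuasiReductive R) (hint : IntTermsAreValues R)
    (r : Recursors Sg) (hrec : IncludesRecursors R r)
    (gt : TermRel Sg) (hgt : IsBoundingOrder R gt)
    (x y z a x₁ x₂ y₁ y₂ : Sg.Var tInt) (hvars : [x, y, z, a, x₁, x₂, y₁, y₂].Nodup) :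
    IsCondBoundedInductiveTheorem R gt
      { ⟨box₁ (v x) (box₂ (v y) (v z)), box₂ (box₁ (v x) (v y)) (v z), tt⟩,
        ⟨box₁ (v x) (v y), box₂ (v y) (v x), tt⟩ }
      { ⟨r.tailup □₁ (v x) (v y) (v a), r.taildn □₂ (v x) (v y) (v a), tt⟩ }
      { ⟨r.tailup □₁ (v x) (v y) (v a),
          r.taildn □₂ (v x₁) (v y) (box₁ (v x) (v a)),
          v x ≤ₜ v y ∧ₜ v x₁ =ₜ v x +ₜ lit 1 ∧ₜ v y₁ =ₜ v y -ₜ lit 1⟩,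
        ⟨r.taildn □₂ (v x₁) (v y) (box₁ (v x) (v a)),
          r.taildn □₂ (v x₁) (v y₁) (box₁ (v x) (box₂ (v a) (v y))),
          v x ≤ₜ v y ∧ₜ v x₁ =ₜ v x +ₜ lit 1 ∧ₜ v y₁ =ₜ v y -ₜ lit 1 ∧ₜ v x₁ ≤ₜ v y⟩ } ∧
    IsCondBoundedInductiveTheorem R gt
      { ⟨box₁ (v x) (box₁ (v y) (v z)), box₁ (v y) (box₁ (v x) (v z)), tt⟩,
        ⟨box₁ (v x) (v y), box₂ (v y) (v x), tt⟩ }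
      { ⟨r.taildn □₂ (v x) (v y) (v a), r.recdn □₁ (v x) (v y) (v a), tt⟩ }
      { ⟨r.taildn □₂ (v x) (v y) (v a),
          r.recdn □₁ (v x) (v y₁) (box₂ (v a) (v y)),
          v x ≤ₜ v y ∧ₜ v y₁ =ₜ v y -ₜ lit 1⟩,
        ⟨r.recdn □₁ (v x) (v y₁) (box₂ (v a) (v y)),
          box₁ (v y₁) (box₁ (v y) (r.recdn □₁ (v x) (v y₂) (v a))),
          v x ≤ₜ v y ∧ₜ v x ≤ₜ v y₁ ∧ₜ v y₂ =ₜ v y₁ -ₜ lit 1⟩ } ∧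
    IsCondBoundedInductiveTheorem R gt
      { ⟨box₁ (box₁ (v x) (v y)) (v z), box₁ (box₁ (v x) (v z)) (v y), tt⟩,
        ⟨box₁ (v x) (v y), box₂ (v y) (v x), tt⟩ }
      { ⟨r.tailup □₂ (v x) (v y) (v a), r.recup □₁ (v x) (v y) (v a), tt⟩ }
      { ⟨r.tailup □₂ (v x) (v y) (v a),
          r.recup □₁ (v x₁) (v y) (box₂ (v x) (v a)),
          v x ≤ₜ v y ∧ₜ v x₁ =ₜ v x +ₜ lit 1⟩,
        ⟨r.recup □₁ (v x₁) (v y) (box₂ (v x) (v a)),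
          box₁ (box₁ (r.recup □₁ (v x₂) (v y) (v a)) (v x)) (v x₁),
          v x ≤ₜ v y ∧ₜ v x₁ ≤ₜ v y ∧ₜ v x₂ =ₜ v x₁ +ₜ lit 1⟩ } ∧
    IsCondBoundedInductiveTheorem R gt
      { ⟨box₁ (box₂ (v x) (v y)) (v z), box₂ (v x) (box₁ (v y) (v z)), tt⟩,
        ⟨box₁ (v x) (v y), box₂ (v y) (v x), tt⟩ }
      { ⟨r.recup □₁ (v x) (v y) (v a), r.recdn □₂ (v x) (v y) (v a), tt⟩ }
      { ⟨r.recup □₁ (v x) (v y) (v a),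
          box₁ (r.recdn □₂ (v x₁) (v y) (v a)) (v x),
          v x ≤ₜ v y ∧ₜ v x₁ =ₜ v x +ₜ lit 1⟩,
        ⟨box₂ (v y) (r.recdn □₂ (v x) (v y₁) (v a)),
          box₂ (v y) (box₁ (r.recdn □₂ (v x₁) (v y₁) (v a)) (v x)),
          v x ≤ₜ v y ∧ₜ v x₁ =ₜ v x +ₜ lit 1 ∧ₜ v y₁ =ₜ v y -ₜ lit 1 ∧ₜ v x₁ ≤ₜ v y⟩ } := by
  exact ⟨tailup_taildn_isCondBoundedInductiveTheorem hR hqr hint hrec hgt hvars,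
    taildn_recdn_isCondBoundedInductiveTheorem hR hqr hint hrec hgt hvars,
    tailup_recup_isCondBoundedInductiveTheorem hR hqr hint hrec hgt hvars,
    recup_recdn_isCondBoundedInductiveTheorem hR hqr hint hrec hgt hvars⟩
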